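/- **Conventions.** Links are smooth embeddings of disjoint circles in $\mathbb R^3$, considered up to smooth isotopy; the *unlink* of two components is the class of two disjoint round circles in a plane bounding disjoint disks. Diagrams are projections to the $xy$-plane, seen from above (so a smaller $z$ means a greater depth), and are regular: immersed, with finitely many multiple points, all of them transverse double points. *Changing* a set $S$ of crossings exchanges over and under exactly at the crossings in $S$; the result is well defined up to isotopy. A two-component link is *$(a,b)$-unlinkable* (equivalently, $(a,b)$ is in its *unlinking region*) if it has a diagram in which changing at most $a$ self-crossings of the first component and at most $b$ self-crossings of the second component produces the unlink. A two-component link with a regular diagram is in *parallel strands disk form* with respect to the first component if * the second component is a round circle parallel to the page; * over the closed disk that this circle bounds in the page, the first component consists of straight strands parallel to the $y$-axis; * all strands pass through the disk in the same way: either each of them crosses over the upper half of the circle and under the lower half, or each of them crosses under the upper half and over the lower half; * the strands are connected to each other on the left of the circle only: in the diagram, the first component does not meet the horizontal half-line that leaves the circle at its rightmost point to the right. **Proposition.** Let $L$ be a two-component link in parallel strands disk form with respect to the first component, such that both components are unknotted and the linking number is $0$. Let $N$ be the number of self-crossings of the first component in this diagram. Then: 1. There is a base point $b$ on the first component, not at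 a self-crossing of it, such that the following holds. Traverse the first component once, starting at $b$. Let $S_{\downarrow}$ be the set of self-crossings of the first component that have to be changed so that the first passage through each of its self-crossings is over and the second one is under (the component descends into the page), and let $S_{\uparrow}$ be the set of those that have to be changed so that the first passage is always under and the second one over (it ascends). Then changing $S_{\downarrow}$ produces the unlink, changing $S_{\uparrow}$ produces the unlink, and $\min(|S_{\downarrow}|,|S_{\uparrow}|)\le\lfloor N/2\rfloor$. 2. $L$ is $(\lfloor N/2\rfloor,0)$-unlinkable, i.e. $(\lfloor N/2\rfloor,0)$ is in the unlinking region of $L$. -/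

import Mathlib

open scoped ContDiff

namespace ColoredUnlinking

/-- `(i, s)` and `(j, t)` are the same point of a disjoint union of circles `ℝ / ℤ` indexed
by `ι`. -/
def SamePoint {ι : Type} (i : ι) (s : ℝ) (j : ι) (t : ℝ) : Prop :=
  i = j ∧ ∃ n : ℤ, t = s + n

/-- A family of maps `ℝ → ℝ³` is a smooth embedding of a disjoint union of circles `ℝ / ℤ`. -/
structure IsLink {ι : Type} (c : ι → ℝ → (Fin 3 → ℝ)) : Prop where
  smooth : ∀ i, ContDiff ℝ ∞ (c i)
  periodic : ∀ i, Function.Periodic (c i) 1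
  immersed : ∀ i t, deriv (c i) t ≠ 0
  injective : ∀ i j s t, c i s = c j t → SamePoint i s j t

/-- A smooth link in `ℝ³` with components indexed by `ι`, given by parametrizations of its
components as closed curves of period `1`. -/
structure Link (ι : Type) where
  curve : ι → ℝ → (Fin 3 → ℝ)
  isLink : IsLink curve

/-- Smooth isotopy of links: a smooth one-parameter family of links from `L` to `L'`. -/
def Isotopic {ι : Type} (L L' : Link ι) : Prop :=
  ∃ F : ℝ → ι → ℝ → (Fin 3 → ℝ),
    (∀ i, ContDiff ℝ ∞ (fun p : ℝ × ℝ => F p.1 i p.2)) ∧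
    (∀ τ ∈ Set.Icc (0 : ℝ) 1, IsLink (F τ)) ∧
    F 0 = L.curve ∧ F 1 = L'.curve

/-- The standard unlink: `n` unit circles in the plane `z = 0`, bounding disjoint disks, with
centres `(0, 0, 0), (3, 0, 0), (6, 0, 0), …`. -/
noncomputable def stdCurve (n : ℕ) (i : Fin n) (t : ℝ) : Fin 3 → ℝ :=
  ![3 * (i : ℕ) + Real.cos (2 * Real.pi * t), Real.sin (2 * Real.pi * t), 0]

theorem isLink_stdCurve (n : ℕ) : IsLink (stdCurve n) where
  smooth i := by
    rw [contDiff_pi]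
    intro k
    fin_cases k <;> simp [stdCurve] <;> fun_prop
  periodic i t := by
    have h : 2 * Real.pi * (t + 1) = 2 * Real.pi * t + 2 * Real.pi := by ring
    simp [stdCurve, h]
  immersed i t h := by
    have h0 : HasDerivAt (fun t => 3 * ((i : ℕ) : ℝ) + Real.cos (2 * Real.pi * t))
        (-Real.sin (2 * Real.pi * t) * (2 * Real.pi)) t := by
      have := ((hasDerivAt_id t).const_mul (2 * Real.pi)).cos.const_add (3 * ((i : ℕ) : ℝ))
      simpa using this
    have h1 : HasDerivAt (fun t => Real.sin (2 * Real.pi * t))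
        (Real.cos (2 * Real.pi * t) * (2 * Real.pi)) t := by
      have := ((hasDerivAt_id t).const_mul (2 * Real.pi)).sin
      simpa using this
    have hd : HasDerivAt (stdCurve n i)
        ![-Real.sin (2 * Real.pi * t) * (2 * Real.pi),
          Real.cos (2 * Real.pi * t) * (2 * Real.pi), 0] t := by
      rw [hasDerivAt_pi]
      intro k
      fin_cases k
      · exact h0
      · exact h1
      · exact hasDerivAt_const t (0 : ℝ)
    rw [hd.deriv] at h
    have e0 := congrFun h 0
    have e1 := congrFun h 1
    have hpi := Real.pi_pos.ne'
    simp [hpi] at e0 e1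
    have := Real.sin_sq_add_cos_sq (2 * Real.pi * t)
    rw [e0, e1] at this
    norm_num at this
  injective i j s t h := by
    have e0 := congrFun h 0
    have e1 := congrFun h 1
    simp only [stdCurve, Matrix.cons_val_zero, Matrix.cons_val_one] at e0 e1
    have hij : (i : ℕ) = (j : ℕ) := by
      have b1 := Real.neg_one_le_cos (2 * Real.pi * s)
      have b2 := Real.cos_le_one (2 * Real.pi * s)
      have b3 := Real.neg_one_le_cos (2 * Real.pi * t)
      have b4 := Real.cos_le_one (2 * Real.pi * t)
      rcases lt_trichotomy (i : ℕ) (j : ℕ) with hl | hl | hl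
      · have : ((i : ℕ) : ℝ) + 1 ≤ (j : ℕ) := by exact_mod_cast hl
        linarith
      · exact hl
      · have : ((j : ℕ) : ℝ) + 1 ≤ (i : ℕ) := by exact_mod_cast hl
        linarith
    refine ⟨Fin.ext hij, ?_⟩
    rw [hij] at e0
    have hc : Real.cos (2 * Real.pi * t) = Real.cos (2 * Real.pi * s) := by linarith
    have ha := Real.Angle.cos_sin_inj hc e1.symm
    obtain ⟨k, hk⟩ := Real.Angle.angle_eq_iff_two_pi_dvd_sub.mp ha
    refine ⟨k, ?_⟩
    have hpi := Real.pi_pos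
    have : 2 * Real.pi * (t - s - k) = 0 := by linarith
    have h2 : t - s - k = 0 := by
      rcases mul_eq_zero.mp this with h3 | h3
      · linarith
      · exact h3
    linarith

noncomputable def stdUnlink (n : ℕ) : Link (Fin n) := ⟨stdCurve n, isLink_stdCurve n⟩

/-- The unlink of `n` components; for `n = 1` this is the unknot. -/
def Link.IsUnlink {n : ℕ} (L : Link (Fin n)) : Prop := Isotopic L (stdUnlink n)

namespace Link

variable {ι : Type}

/-- A single component, as a knot. -/
def component (L : Link ι) (i : ι) : Link (Fin 1) where
  curve _ := L.curve i
  isLink :=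
    { smooth := fun _ => L.isLink.smooth i
      periodic := fun _ => L.isLink.periodic i
      immersed := fun _ => L.isLink.immersed i
      injective := fun _ _ s t h =>
        ⟨Subsingleton.elim _ _, (L.isLink.injective i i s t h).2⟩ }

/-- The three coordinates. Diagrams are seen from above: they are projections to the `xy`-plane,
and a smaller `z` means a greater depth (further into the page). -/
def x (L : Link ι) (i : ι) (t : ℝ) : ℝ := L.curve i t 0

/-- The second coordinate. -/
def y (L : Link ι) (i : ι) (t : ℝ) : ℝ := L.curve i t 1

/-- The height above the page. -/
def z (L : Link ι) (i : ι) (t : ℝ) : ℝ := L.curve i t 2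

/-- The projection to the page. -/
def proj (L : Link ι) (i : ι) (t : ℝ) : ℝ × ℝ := (L.x i t, L.y i t)

/-- Two different points of the link lie over the same point of the page. -/
def Cross (L : Link ι) (i : ι) (s : ℝ) (j : ι) (t : ℝ) : Prop :=
  ¬ SamePoint i s j t ∧ L.proj i s = L.proj j t

/-- The cross product of the projected velocities at two points of the link. -/
noncomputable def planarDet (L : Link ι) (i : ι) (s : ℝ) (j : ι) (t : ℝ) : ℝ :=
  deriv (L.x i) s * deriv (L.y j) t - deriv (L.y i) s * deriv (L.x j) t

/-- The projection of the link is a regular diagram: it is an immersion whose only multiple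
points are finitely many transverse double points. -/
structure IsRegular (L : Link ι) : Prop where
  immersed : ∀ i t, deriv (L.x i) t ≠ 0 ∨ deriv (L.y i) t ≠ 0
  transverse : ∀ i s j t, L.Cross i s j t → L.planarDet i s j t ≠ 0
  no_triple : ∀ i s j t k u, L.Cross i s j t → L.Cross j t k u → ¬ L.Cross i s k u
  finite : {P | ∃ i s j t, L.Cross i s j t ∧ L.proj i s = P}.Finite

/-- The self-crossings of the component `i` in the diagram (as double points in the page). -/
def selfCrossings (L : Link ι) (i : ι) : Set (ℝ × ℝ) :=
  {P | ∃ s t, L.Cross i s i t ∧ L.proj i s = P}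

/-- The diagram of `L'` arises from that of `L` by changing exactly the crossings that lie in
`S`: the projections agree, over and under are exchanged at the crossings in `S`, and they are
kept at all others. -/
structure IsCrossingChange (L : Link ι) (S : Set (ℝ × ℝ)) (L' : Link ι) : Prop where
  proj_eq : ∀ i t, L'.proj i t = L.proj i t
  changed : ∀ i s j t, L.Cross i s j t → L.proj i s ∈ S →
    (L'.z i s < L'.z j t ↔ L.z j t < L.z i s)
  kept : ∀ i s j t, L.Cross i s j t → L.proj i s ∉ S →
    (L'.z i s < L'.z j t ↔ L.z i s < L.z j t)

/-- Changing the crossings in `S` produces the unlink. (The diagram determines the link only up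
to isotopy: some link has the changed diagram, and every link with this diagram is the
unlink.) -/
def ChangeYieldsUnlink {n : ℕ} (L : Link (Fin n)) (S : Set (ℝ × ℝ)) : Prop :=
  (∃ L', L.IsCrossingChange S L') ∧ ∀ L', L.IsCrossingChange S L' → L'.IsUnlink

/-- `L` is `(a, b)`-unlinkable, i.e. `(a, b)` is in the unlinking region of `L`: in some diagram
of `L`, changing at most `a` self-crossings of the first component and at most `b` self-crossings
of the second one produces the unlink. -/
def Unlinkable (L : Link (Fin 2)) (a b : ℕ) : Prop :=
  ∃ D : Link (Fin 2), Isotopic L D ∧ D.IsRegular ∧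
    ∃ S T : Set (ℝ × ℝ), S ⊆ D.selfCrossings 0 ∧ T ⊆ D.selfCrossings 1 ∧
      S.ncard ≤ a ∧ T.ncard ≤ b ∧ D.ChangeYieldsUnlink (S ∪ T)

/-- The sign of the crossing of the first component at `s` with the second component at `t`
(the sign of `over × under`). -/
noncomputable def crossingSign (L : Link (Fin 2)) (s t : ℝ) : ℤ :=
  SignType.sign (L.planarDet 0 s 1 t * (L.z 0 s - L.z 1 t))

/-- The linking number of the two components: half of the sum of the signs of the crossings
between them. -/
noncomputable def linkingNumber (L : Link (Fin 2)) : ℚ :=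
  (∑ᶠ p ∈ {p : ℝ × ℝ | p.1 ∈ Set.Ico (0 : ℝ) 1 ∧ p.2 ∈ Set.Ico (0 : ℝ) 1 ∧
    L.proj 0 p.1 = L.proj 1 p.2}, (L.crossingSign p.1 p.2 : ℚ)) / 2

/-- The self-crossings of component `i` that must be changed so that the component, traversed
from the parameter `b` on, goes over at the first and under at the second passage through each of
its self-crossings, i.e. descends into the page. -/
def descendingChanges (L : Link ι) (i : ι) (b : ℝ) : Set (ℝ × ℝ) :=
  {P | ∃ s t, b ≤ s ∧ s < t ∧ t < b + 1 ∧ L.proj i s = P ∧ L.proj i t = P ∧ L.z i s < L.z i t}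

/-- The self-crossings of component `i` that must be changed so that the component, traversed
from the parameter `b` on, goes under first and over second at each of its self-crossings, i.e.
ascends out of the page. -/
def ascendingChanges (L : Link ι) (i : ι) (b : ℝ) : Set (ℝ × ℝ) :=
  {P | ∃ s t, b ≤ s ∧ s < t ∧ t < b + 1 ∧ L.proj i s = P ∧ L.proj i t = P ∧ L.z i t < L.z i s}

/-- Parallel strands disk form (with respect to the first component), with a regular diagram.
The second component is the round circle with centre `(p, q, h)` and radius `r` parallel to the
page. -/
structure IsParallelStrandsDiskForm (L : Link (Fin 2)) (p q h r : ℝ) : Prop where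
  regular : L.IsRegular
  radius_pos : 0 < r
  circle : Set.range (L.curve 1) = {v | (v 0 - p) ^ 2 + (v 1 - q) ^ 2 = r ^ 2 ∧ v 2 = h}
  /-- Where it lies over or under the closed disk, the first component consists of strands that
  are straight and parallel (to the `y`-axis) in the diagram. By transversality, the strands do
  not cross each other there, and none touches the circle at its leftmost or rightmost point. -/
  parallel : ∀ t, (L.x 0 t - p) ^ 2 + (L.y 0 t - q) ^ 2 ≤ r ^ 2 → deriv (L.x 0) t = 0
  /-- The strands pass through the disk, all in the same way: either each of them crosses over
  the upper half of the circle and under the lower half, or the other way round. -/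
  through :
    (∀ t, (L.x 0 t - p) ^ 2 + (L.y 0 t - q) ^ 2 = r ^ 2 →
      0 < (L.y 0 t - q) * (L.z 0 t - h)) ∨
    (∀ t, (L.x 0 t - p) ^ 2 + (L.y 0 t - q) ^ 2 = r ^ 2 →
      (L.y 0 t - q) * (L.z 0 t - h) < 0)
  /-- The strands are connected to each other on the left of the circle only: the first component
  never crosses the half-line that leaves the circle to the right. -/
  left : ∀ t, L.y 0 t = q → L.x 0 t < p + r

end Link

end ColoredUnlinking

/-! Let `K` be the first component, `U` the circle, and `A` the vertical line through the leftmost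
point of `U`.

Winding. By Thales, the projection of `K` meets the circle exactly where the horizontal diameter is
seen from it under a right angle. As all strands pass through `U` alike, the signs of the mixed
crossings agree, up to one common factor, with the directions in which this angle passes a right
angle. The half-line on the right is avoided, so only the leftmost endpoint of the diameter can
contribute to the total change of the angle. Hence linking number `0` says that `K` does not wind
around `A` (`exists_periodic_log`).

Base point. Let `b` be a farthest point of `K` from `A`, measured in the page. Give `K` a height
that rises on a short arc around `b` and falls on the rest. After a small shift of the axis, that
arc is farther out than everything else, and its projection is embedded, so both passages of each
self-crossing lie on the falling part: the diagram of `K` descends from `b` on. The crossings with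
`U` are retained by tilting `U` steeply about its horizontal diameter while `K` stays at heights in
`[-1, 1]` (`exists_base_point`).

Unlinking. Enlarge `U` to the right, then contract `K` in polar coordinates around the shifted axis:
the angle, which is periodic, goes to `π`, and the radius to a standard profile. Two points of `K`
at equal height lie one on the rising and one on the falling arc, so their radii differ and `K`
stays embedded. It ends as a vertical ellipse to the left of `U` (`isUnlink_of_descending`).
Reflecting the heights of `K` settles the ascending case with the same base point.

The descending and the ascending changes are disjoint sets of self-crossings, so one of them has at
most `⌊N/2⌋` elements. -/

namespace ColoredUnlinking

/-! ### Loops, smooth families of links, and isotopies -/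

/-- A smooth simple closed curve in `ℝ³`. -/
structure IsLoop (c : ℝ → (Fin 3 → ℝ)) : Prop where
  smooth : ContDiff ℝ ∞ c
  periodic : Function.Periodic c 1
  immersed : ∀ t, deriv c t ≠ 0
  injective : ∀ s t, c s = c t → ∃ n : ℤ, t = s + n

theorem isLink_pair {A B : ℝ → (Fin 3 → ℝ)} (hA : IsLoop A) (hB : IsLoop B)
    (h : ∀ s t, A s ≠ B t) : IsLink ![A, B] where
  smooth i := by fin_cases i; exacts [hA.smooth, hB.smooth]
  periodic i := by fin_cases i; exacts [hA.periodic, hB.periodic]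
  immersed i := by fin_cases i; exacts [hA.immersed, hB.immersed]
  injective i j s t e := by
    fin_cases i <;> fin_cases j
    · exact ⟨rfl, hA.injective s t e⟩
    · exact absurd e (h s t)
    · exact absurd e.symm (h t s)
    · exact ⟨rfl, hB.injective s t e⟩

theorem deriv_vec3 {x y z : ℝ → ℝ} {t : ℝ} (hx : DifferentiableAt ℝ x t)
    (hy : DifferentiableAt ℝ y t) (hz : DifferentiableAt ℝ z t) :
    deriv (fun t => ![x t, y t, z t]) t = ![deriv x t, deriv y t, deriv z t] := by
  refine HasDerivAt.deriv ?_
  rw [hasDerivAt_pi]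
  intro k
  fin_cases k
  exacts [hx.hasDerivAt, hy.hasDerivAt, hz.hasDerivAt]

theorem contDiff_vec3 {E : Type*} [NormedAddCommGroup E] [NormedSpace ℝ E] {x y z : E → ℝ}
    (hx : ContDiff ℝ ∞ x) (hy : ContDiff ℝ ∞ y) (hz : ContDiff ℝ ∞ z) :
    ContDiff ℝ ∞ (fun t => ![x t, y t, z t]) := by
  rw [contDiff_pi]
  intro k
  fin_cases k
  exacts [hx, hy, hz]

theorem isLoop_vec3 {x y z : ℝ → ℝ} (hx : ContDiff ℝ ∞ x) (hy : ContDiff ℝ ∞ y)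
    (hz : ContDiff ℝ ∞ z) (px : Function.Periodic x 1) (py : Function.Periodic y 1)
    (pz : Function.Periodic z 1)
    (im : ∀ t, deriv x t = 0 → deriv y t = 0 → deriv z t ≠ 0)
    (inj : ∀ s t, x s = x t → y s = y t → z s = z t → ∃ n : ℤ, t = s + n) :
    IsLoop (fun t => ![x t, y t, z t]) where
  smooth := contDiff_vec3 hx hy hz
  periodic t := by simp only [px t, py t, pz t]
  immersed t h := by
    rw [deriv_vec3 (hx.differentiable (by simp) t) (hy.differentiable (by simp) t)
      (hz.differentiable (by simp) t)] at h
    exact im t (congrFun h 0) (congrFun h 1) (congrFun h 2)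
  injective s t h := inj s t (congrFun h 0) (congrFun h 1) (congrFun h 2)

theorem Link.curve_eq_vec3 {ι : Type} (L : Link ι) (i : ι) :
    L.curve i = fun t => ![L.x i t, L.y i t, L.z i t] := by
  funext t k
  fin_cases k <;> rfl

theorem Link.contDiff_x {ι : Type} (L : Link ι) (i : ι) : ContDiff ℝ ∞ (L.x i) :=
  contDiff_pi.1 (L.isLink.smooth i) 0

theorem Link.contDiff_y {ι : Type} (L : Link ι) (i : ι) : ContDiff ℝ ∞ (L.y i) :=
  contDiff_pi.1 (L.isLink.smooth i) 1

theorem Link.contDiff_z {ι : Type} (L : Link ι) (i : ι) : ContDiff ℝ ∞ (L.z i) :=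
  contDiff_pi.1 (L.isLink.smooth i) 2

theorem Link.periodic_x {ι : Type} (L : Link ι) (i : ι) : Function.Periodic (L.x i) 1 :=
  fun t => congrFun (L.isLink.periodic i t) 0

theorem Link.periodic_y {ι : Type} (L : Link ι) (i : ι) : Function.Periodic (L.y i) 1 :=
  fun t => congrFun (L.isLink.periodic i t) 1

theorem Link.periodic_z {ι : Type} (L : Link ι) (i : ι) : Function.Periodic (L.z i) 1 :=
  fun t => congrFun (L.isLink.periodic i t) 2

theorem Isotopic.refl {ι : Type} (L : Link ι) : Isotopic L L :=
  ⟨fun _ => L.curve, fun i => (L.isLink.smooth i).comp contDiff_snd, fun _ _ => L.isLink,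
    rfl, rfl⟩

theorem Isotopic.trans {ι : Type} {L₁ L₂ L₃ : Link ι} (h : Isotopic L₁ L₂)
    (h' : Isotopic L₂ L₃) : Isotopic L₁ L₃ := by
  obtain ⟨F, hF, lF, F0, F1⟩ := h
  obtain ⟨G, hG, lG, G0, G1⟩ := h'
  -- Both families are slowed down to keep the concatenation smooth: `F` moves only for `τ` in `[0,
  -- 1/3]` and `G` only in `[2/3, 1]`. Since one of them always rests at `L₂`, the sum minus `L₂`
  -- describes both without a case split.
  let σ := Real.smoothTransition
  have hσ : ContDiff ℝ ∞ σ := Real.smoothTransition.contDiff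
  have early : ∀ τ : ℝ, τ ≤ 2 / 3 → (fun i t => F (σ (3 * τ)) i t + G (σ (3 * τ - 2)) i t -
      L₂.curve i t) = F (σ (3 * τ)) := by
    intro τ hτ
    have : σ (3 * τ - 2) = 0 := Real.smoothTransition.zero_of_nonpos (by linarith)
    funext i t
    rw [this, G0]
    abel
  have late : ∀ τ : ℝ, 1 / 3 ≤ τ → (fun i t => F (σ (3 * τ)) i t + G (σ (3 * τ - 2)) i t -
      L₂.curve i t) = G (σ (3 * τ - 2)) := by
    intro τ hτ
    have : σ (3 * τ) = 1 := Real.smoothTransition.one_of_one_le (by linarith)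
    funext i t
    rw [this, F1]
    abel
  refine ⟨fun τ i t => F (σ (3 * τ)) i t + G (σ (3 * τ - 2)) i t - L₂.curve i t, ?_, ?_, ?_, ?_⟩
  · intro i
    have e1 : ContDiff ℝ ∞ (fun p : ℝ × ℝ => (σ (3 * p.1), p.2)) := by fun_prop
    have e2 : ContDiff ℝ ∞ (fun p : ℝ × ℝ => (σ (3 * p.1 - 2), p.2)) := by fun_prop
    exact (((hF i).comp e1).add ((hG i).comp e2)).sub ((L₂.isLink.smooth i).comp contDiff_snd)
  · intro τ _
    beta_reduce
    have mem : ∀ u, σ u ∈ Set.Icc (0 : ℝ) 1 := fun u =>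
      ⟨Real.smoothTransition.nonneg u, Real.smoothTransition.le_one u⟩
    rcases le_total τ (1 / 2) with h | h
    · rw [early τ (by linarith)]
      exact lF _ (mem _)
    · rw [late τ (by linarith)]
      exact lG _ (mem _)
  · beta_reduce
    rw [early 0 (by norm_num), ← F0]
    congr 1
    exact Real.smoothTransition.zero_of_nonpos (by norm_num)
  · beta_reduce
    rw [late 1 (by norm_num), ← G1]
    congr 1
    exact Real.smoothTransition.one_of_one_le (by norm_num)

/-- A two-component link is the unlink if it moves by a smooth family of pairs of disjoint loops
to a link which is the unlink. -/
theorem Link.isUnlink_of_family {L : Link (Fin 2)} (A B : ℝ → ℝ → (Fin 3 → ℝ))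
    (sA : ContDiff ℝ ∞ (fun p : ℝ × ℝ => A p.1 p.2))
    (sB : ContDiff ℝ ∞ (fun p : ℝ × ℝ => B p.1 p.2))
    (hA : ∀ τ ∈ Set.Icc (0 : ℝ) 1, IsLoop (A τ)) (hB : ∀ τ ∈ Set.Icc (0 : ℝ) 1, IsLoop (B τ))
    (disj : ∀ τ ∈ Set.Icc (0 : ℝ) 1, ∀ s t, A τ s ≠ B τ t)
    (start : L.curve = ![A 0, B 0])
    (final : ∀ L' : Link (Fin 2), L'.curve = ![A 1, B 1] → L'.IsUnlink) : L.IsUnlink := by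
  have hl : ∀ τ ∈ Set.Icc (0 : ℝ) 1, IsLink ![A τ, B τ] := fun τ h =>
    isLink_pair (hA τ h) (hB τ h) (disj τ h)
  have : Isotopic L ⟨![A 1, B 1], hl 1 (by simp)⟩ := by
    refine ⟨fun τ => ![A τ, B τ], ?_, hl, start.symm, rfl⟩
    intro i
    fin_cases i
    exacts [sA, sB]
  exact this.trans (final _ rfl)

/-- Links with the same diagram are isotopic. -/
theorem Link.isotopic_of_same_diagram {ι : Type} {L L' : Link ι}
    (immersed : ∀ i t, deriv (L.x i) t ≠ 0 ∨ deriv (L.y i) t ≠ 0)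
    (proj_eq : ∀ i t, L'.proj i t = L.proj i t)
    (order : ∀ i s j t, L.Cross i s j t → L.z i s < L.z j t → L'.z i s < L'.z j t) :
    Isotopic L L' := by
  have ex : ∀ i t, L'.x i t = L.x i t := fun i t => congrArg Prod.fst (proj_eq i t)
  have ey : ∀ i t, L'.y i t = L.y i t := fun i t => congrArg Prod.snd (proj_eq i t)
  -- Heights are interpolated linearly over the fixed projection; a strict order of two heights that
  -- holds at both ends holds throughout.
  let Z : ℝ → ι → ℝ → ℝ := fun τ i t => (1 - τ) * L.z i t + τ * L'.z i t
  have key : ∀ τ ∈ Set.Icc (0 : ℝ) 1, ∀ i s j t, L.Cross i s j t → L.z i s < L.z j t →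
      Z τ i s < Z τ j t := by
    intro τ hτ i s j t hc hz
    have h' := order i s j t hc hz
    simp only [Z]
    rcases eq_or_lt_of_le hτ.1 with h0 | h0
    · subst h0
      simpa using hz
    · have := mul_le_mul_of_nonneg_left hz.le (sub_nonneg.2 hτ.2)
      have := mul_lt_mul_of_pos_left h' h0
      linarith
  refine ⟨fun τ i t => ![L.x i t, L.y i t, Z τ i t], ?_, ?_, ?_, ?_⟩
  · intro i
    have hx := L.contDiff_x i
    have hy := L.contDiff_y i
    have hz := L.contDiff_z i
    have hz' := L'.contDiff_z i
    exact contDiff_vec3 (by fun_prop) (by fun_prop) (by simp only [Z]; fun_prop)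
  · intro τ hτ
    have hZ : ∀ i, ContDiff ℝ ∞ (Z τ i) := by
      intro i
      have hz := L.contDiff_z i
      have hz' := L'.contDiff_z i
      simp only [Z]
      fun_prop
    refine ⟨fun i => contDiff_vec3 (L.contDiff_x i) (L.contDiff_y i) (hZ i), ?_, ?_, ?_⟩
    · intro i t
      simp only [Z, L.periodic_x i t, L.periodic_y i t, L.periodic_z i t, L'.periodic_z i t]
    · intro i t h
      rw [deriv_vec3 ((L.contDiff_x i).differentiable (by simp) t)
        ((L.contDiff_y i).differentiable (by simp) t) ((hZ i).differentiable (by simp) t)] at h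
      rcases immersed i t with h' | h'
      exacts [h' (congrFun h 0), h' (congrFun h 1)]
    · intro i j s t h
      by_contra hne
      have hx : L.x i s = L.x j t := congrFun h 0
      have hy : L.y i s = L.y j t := congrFun h 1
      have hz : Z τ i s = Z τ j t := congrFun h 2
      have hc : L.Cross i s j t := ⟨hne, by simp [Link.proj, hx, hy]⟩
      have hne' : ¬ SamePoint j t i s := by
        rintro ⟨rfl, n, rfl⟩
        exact hne ⟨rfl, -n, by simp⟩
      have hc' : L.Cross j t i s := ⟨hne', hc.2.symm⟩
      rcases lt_trichotomy (L.z i s) (L.z j t) with hl | hl | hl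
      · exact (key τ hτ i s j t hc hl).ne hz
      · refine hne (L.isLink.injective i j s t ?_)
        simp only [Link.curve_eq_vec3, hx, hy, hl]
      · exact (key τ hτ j t i s hc' hl).ne hz.symm
  · funext i
    rw [Link.curve_eq_vec3]
    simp [Z]
  · funext i
    rw [Link.curve_eq_vec3 L']
    simp [Z, ex, ey]

/-! ### Logarithms along closed curves and the degree as a signed count -/

/-- Integrating `γ' / γ` gives the logarithm: `exp (-w) * γ` then has derivative zero. -/
theorem exists_smooth_log {γ : ℝ → ℂ} (hγ : ContDiff ℝ ∞ γ) (h0 : ∀ t, γ t ≠ 0) :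
    ∃ w : ℝ → ℂ, ContDiff ℝ ∞ w ∧ ∀ t, Complex.exp (w t) = γ t := by
  have hd : ContDiff ℝ ∞ (deriv γ) := (contDiff_infty_iff_deriv.1 hγ).2
  have hq : ContDiff ℝ ∞ (fun t => deriv γ t / γ t) := by
    simp only [div_eq_mul_inv]
    exact hd.mul (hγ.inv h0)
  let w : ℝ → ℂ := fun t => Complex.log (γ 0) + ∫ s in (0 : ℝ)..t, deriv γ s / γ s
  have hw : ∀ t, HasDerivAt w (deriv γ t / γ t) t := fun t =>
    (intervalIntegral.integral_hasDerivAt_right (hq.continuous.intervalIntegrable _ _)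
      (hq.continuous.stronglyMeasurableAtFilter _ _) hq.continuous.continuousAt).const_add _
  refine ⟨w, ?_, ?_⟩
  · rw [contDiff_infty_iff_deriv]
    refine ⟨fun t => (hw t).differentiableAt, ?_⟩
    rwa [show deriv w = fun t => deriv γ t / γ t from funext fun t => (hw t).deriv]
  · have hg : ∀ t, HasDerivAt (fun t => Complex.exp (-w t) * γ t) 0 t := by
      intro t
      have hγt : HasDerivAt γ (deriv γ t) t := (hγ.differentiable (by simp) t).hasDerivAt
      refine (((hw t).neg.cexp).mul hγt).congr_deriv ?_
      rw [mul_assoc, ← mul_add, neg_mul, div_mul_cancel₀ _ (h0 t), neg_add_cancel, mul_zero]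
    intro t
    have hc := is_const_of_deriv_eq_zero (fun t => (hg t).differentiableAt)
      (fun t => (hg t).deriv) t 0
    have h00 : Complex.exp (-w 0) * γ 0 = 1 := by
      simp [w, Complex.exp_neg, Complex.exp_log (h0 0), h0 0]
    have h1 : Complex.exp (-w t) * γ t = 1 := hc.trans h00
    rw [Complex.exp_neg] at h1
    exact eq_of_inv_mul_eq_one h1

/-- From `γ' = γ w'` the derivative of `w` is periodic, so `w (t + 1) - w t` is constant, and it is
a period of `exp`. The integer is the winding number around `0`. -/
theorem exists_int_lift_add_one {γ w : ℝ → ℂ} (hw : ContDiff ℝ ∞ w)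
    (hp : Function.Periodic γ 1) (he : ∀ t, Complex.exp (w t) = γ t) :
    ∃ n : ℤ, ∀ t, w (t + 1) = w t + n * (2 * Real.pi * Complex.I) := by
  have hd : ∀ t, HasDerivAt w (deriv w t) t := fun t =>
    (hw.differentiable (by simp) t).hasDerivAt
  have hγ : ∀ t, HasDerivAt γ (Complex.exp (w t) * deriv w t) t := by
    intro t
    rw [show γ = fun t => Complex.exp (w t) from funext fun t => (he t).symm]
    exact (hd t).cexp
  have hdp : ∀ t, deriv w (t + 1) = deriv w t := by
    intro t
    have h1 : HasDerivAt (fun t => γ (t + 1)) (Complex.exp (w (t + 1)) * deriv w (t + 1)) t :=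
      (hγ (t + 1)).comp_add_const t 1
    rw [show (fun t => γ (t + 1)) = γ from funext hp] at h1
    have h2 := h1.unique (hγ t)
    rw [he, he, hp t] at h2
    exact mul_left_cancel₀ (by rw [← he]; exact Complex.exp_ne_zero _) h2
  have hg : ∀ t, HasDerivAt (fun t => w (t + 1) - w t) 0 t := by
    intro t
    have := ((hd (t + 1)).comp_add_const t 1).sub (hd t)
    rwa [hdp, sub_self] at this
  have hc := is_const_of_deriv_eq_zero (fun t => (hg t).differentiableAt) (fun t => (hg t).deriv)
  have h1 : Complex.exp (w (0 + 1)) = Complex.exp (w 0) := by rw [he, he, hp]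
  obtain ⟨n, hn⟩ := Complex.exp_eq_exp_iff_exists_int.1 h1
  refine ⟨n, fun t => ?_⟩
  have := hc t 0
  rw [hn] at this
  linear_combination this

theorem cos_eq_zero_iff_exists_int (x : ℝ) :
    Real.cos x = 0 ↔ ∃ k : ℤ, x / Real.pi + 1 / 2 = k := by
  rw [Real.cos_eq_zero_iff]
  have := Real.pi_ne_zero
  constructor
  · rintro ⟨k, rfl⟩
    exact ⟨k + 1, by push_cast; field_simp; ring⟩
  · rintro ⟨k, hk⟩
    refine ⟨k - 1, ?_⟩
    field_simp at hk
    push_cast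
    linarith

theorem floor_eq_of_no_int {f : ℝ → ℝ} {a b : ℝ} (hf : Continuous f) (hab : a ≤ b)
    (h : ∀ t ∈ Set.Icc a b, ∀ k : ℤ, f t ≠ k) : ⌊f a⌋ = ⌊f b⌋ := by
  by_contra hne
  rcases lt_or_gt_of_ne hne with hl | hl
  · have h1 : f a < ⌊f b⌋ := Int.floor_lt.1 hl
    obtain ⟨t, ht, e⟩ := intermediate_value_Icc hab hf.continuousOn
      ⟨h1.le, Int.floor_le (f b)⟩
    exact h t ht _ e
  · have h1 : f b < ⌊f a⌋ := Int.floor_lt.1 hl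
    obtain ⟨t, ht, e⟩ := intermediate_value_Icc' hab hf.continuousOn
      ⟨h1.le, Int.floor_le (f a)⟩
    exact h t ht _ e

theorem eventually_floor_of_deriv_pos {f : ℝ → ℝ} {c d : ℝ} {k : ℤ} (hf : HasDerivAt f d c)
    (hd : 0 < d) (hk : f c = k) :
    (∀ᶠ t in nhdsWithin c (Set.Ioi c), ⌊f t⌋ = k) ∧
      ∀ᶠ t in nhdsWithin c (Set.Iio c), ⌊f t⌋ = k - 1 := by
  have hs : ∀ᶠ t in nhdsWithin c {c}ᶜ, 0 < slope f c t :=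
    (hasDerivAt_iff_tendsto_slope.1 hf).eventually (lt_mem_nhds hd)
  have h1 : ∀ᶠ t in nhds c, f t < k + 1 :=
    hf.continuousAt.eventually (gt_mem_nhds (by rw [hk]; linarith))
  have h2 : ∀ᶠ t in nhds c, (k : ℝ) - 1 < f t :=
    hf.continuousAt.eventually (lt_mem_nhds (by rw [hk]; linarith))
  constructor
  · filter_upwards [hs.filter_mono (nhdsWithin_mono c fun t ht => ne_of_gt ht),
      h1.filter_mono nhdsWithin_le_nhds, self_mem_nhdsWithin] with t a b ht
    rw [slope_def_field, hk] at a
    have : 0 < t - c := sub_pos.2 ht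
    rw [lt_div_iff₀ this] at a
    rw [Int.floor_eq_iff]
    constructor <;> linarith
  · filter_upwards [hs.filter_mono (nhdsWithin_mono c fun t ht => ne_of_lt ht),
      h2.filter_mono nhdsWithin_le_nhds, self_mem_nhdsWithin] with t a b ht
    rw [slope_def_field, hk] at a
    have : t - c < 0 := sub_neg.2 ht
    rw [lt_div_iff_of_neg this] at a
    rw [Int.floor_eq_iff]
    push_cast
    constructor <;> linarith

/-- The argument is reflected rather than the value, because the floor does not commute with
negation. -/
theorem eventually_floor_of_deriv_neg {f : ℝ → ℝ} {c d : ℝ} {k : ℤ} (hf : HasDerivAt f d c)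
    (hd : d < 0) (hk : f c = k) :
    (∀ᶠ t in nhdsWithin c (Set.Ioi c), ⌊f t⌋ = k - 1) ∧
      ∀ᶠ t in nhdsWithin c (Set.Iio c), ⌊f t⌋ = k := by
  have hg : HasDerivAt (fun t => f (-t)) (-d) (-c) := by
    have h := HasDerivAt.scomp (-c) (by simpa using hf) (hasDerivAt_neg (-c))
    simpa [Function.comp_def] using h
  obtain ⟨h1, h2⟩ := eventually_floor_of_deriv_pos hg (neg_pos.2 hd) (k := k) (by simpa using hk)
  constructor
  · have : Filter.Tendsto (fun t : ℝ => -t) (nhdsWithin c (Set.Ioi c))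
        (nhdsWithin (-c) (Set.Iio (-c))) := tendsto_neg_nhdsGT
    simpa using this.eventually h2
  · have : Filter.Tendsto (fun t : ℝ => -t) (nhdsWithin c (Set.Iio c))
        (nhdsWithin (-c) (Set.Ioi (-c))) := tendsto_neg_nhdsLT
    simpa using this.eventually h1

/-- The signed number of times at which a transverse function passes through integers. -/
theorem sum_sign_eq_floor_sub_floor {f : ℝ → ℝ} (hf : Differentiable ℝ f)
    (Z : Finset ℝ) {a b : ℝ} (hab : a ≤ b) (ha : ∀ k : ℤ, f a ≠ k) (hb : ∀ k : ℤ, f b ≠ k)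
    (hZ : ∀ t, t ∈ Z ↔ t ∈ Set.Ioo a b ∧ ∃ k : ℤ, f t = k) (hd : ∀ t ∈ Z, deriv f t ≠ 0) :
    ∑ t ∈ Z, (SignType.sign (deriv f t) : ℤ) = ⌊f b⌋ - ⌊f a⌋ := by
  -- The smallest passage `c` is split off: the floor is constant from `a` up to `c` and jumps there
  -- by the sign of the derivative. The rest is counted from a point `a₂` between `c` and the next
  -- passage.
  induction Z using Finset.induction_on_min generalizing a with
  | empty =>
    have : ⌊f a⌋ = ⌊f b⌋ := by
      refine floor_eq_of_no_int hf.continuous hab fun t ht k e => ?_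
      rcases eq_or_lt_of_le ht.1 with h | h
      · subst h
        exact ha k e
      rcases eq_or_lt_of_le ht.2 with h' | h'
      · subst h'
        exact hb k e
      · exact absurd ((hZ t).2 ⟨⟨h, h'⟩, k, e⟩) (by simp)
    simp [this]
  | insert c Z hc ih =>
    have hcm : c ∉ Z := fun h => lt_irrefl _ (hc c h)
    obtain ⟨⟨hac, hcb⟩, k, hk⟩ := (hZ c).1 (Finset.mem_insert_self c Z)
    have hdc : deriv f c ≠ 0 := hd c (Finset.mem_insert_self c Z)
    have hfc : HasDerivAt f (deriv f c) c := (hf c).hasDerivAt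
    obtain ⟨m, hm, R, Lft⟩ : ∃ m : ℤ, m - SignType.sign (deriv f c) = 
        (if 0 < deriv f c then k - 1 else k) ∧
        (∀ᶠ t in nhdsWithin c (Set.Ioi c), ⌊f t⌋ = m) ∧
        ∀ᶠ t in nhdsWithin c (Set.Iio c), ⌊f t⌋ = m - SignType.sign (deriv f c) := by
      rcases lt_or_gt_of_ne hdc with h | h
      · obtain ⟨h1, h2⟩ := eventually_floor_of_deriv_neg hfc h hk
        refine ⟨k - 1, ?_, h1, ?_⟩
        · simp [h, h.le]
        · simpa [h] using h2
      · obtain ⟨h1, h2⟩ := eventually_floor_of_deriv_pos hfc h hk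
        refine ⟨k, ?_, h1, ?_⟩
        · simp [h]
        · simpa [h] using h2
    obtain ⟨a', ha', hla', haa'⟩ : ∃ a', ⌊f a'⌋ = m - SignType.sign (deriv f c) ∧ a' < c ∧
        a < a' := by
      obtain ⟨a', h1, h2, h3⟩ := (Lft.and (Filter.Eventually.and self_mem_nhdsWithin
        (nhdsWithin_le_nhds (lt_mem_nhds hac)))).exists
      exact ⟨a', h1, h2, h3⟩
    have hZlow : ∀ t, a < t → t < c → ∀ k : ℤ, f t ≠ k := by
      intro t h1 h2 k e
      have := (hZ t).2 ⟨⟨h1, h2.trans hcb⟩, k, e⟩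
      rcases Finset.mem_insert.1 this with h | h
      · exact h2.ne h
      · exact (hc t h).not_gt h2
    have e1 : ⌊f a⌋ = ⌊f a'⌋ := by
      refine floor_eq_of_no_int hf.continuous haa'.le fun t ht k e => ?_
      rcases eq_or_lt_of_le ht.1 with h | h
      · subst h
        exact ha k e
      · exact hZlow t h (ht.2.trans_lt hla') k e
    have hfin : ∀ᶠ t in nhdsWithin c (Set.Ioi c), ∀ z ∈ Z, t < z := by
      rw [Filter.eventually_all_finset]
      exact fun z hz => nhdsWithin_le_nhds (gt_mem_nhds (hc z hz))
    obtain ⟨a₂, h1, h2, h3, h4⟩ := (R.and (Filter.Eventually.and self_mem_nhdsWithin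
        (Filter.Eventually.and (nhdsWithin_le_nhds (gt_mem_nhds hcb)) hfin))).exists
    replace h2 : c < a₂ := h2
    have key := ih (a := a₂) h3.le ?_ ?_ (fun t ht => hd t (Finset.mem_insert_of_mem ht))
    · rw [Finset.sum_insert hcm, key, e1, ha', h1]
      ring
    · intro k e
      rcases Finset.mem_insert.1 ((hZ a₂).2 ⟨⟨hac.trans h2, h3⟩, k, e⟩) with h | h
      · exact h2.ne' h
      · exact lt_irrefl _ (h4 _ h)
    · intro t
      constructor
      · intro ht
        have := (hZ t).1 (Finset.mem_insert_of_mem ht)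
        exact ⟨⟨h4 t ht, this.1.2⟩, this.2⟩
      · rintro ⟨⟨l, u⟩, k, e⟩
        rcases Finset.mem_insert.1 ((hZ t).2 ⟨⟨(hac.trans h2).trans l, u⟩, k, e⟩) with h | h
        · exact absurd h (h2.trans l).ne'
        · exact h

/-- The signed number of zeros of the cosine of an angle in one period is twice the degree. -/
theorem sum_sign_eq_two_mul_degree {ψ : ℝ → ℝ} (hψ : Differentiable ℝ ψ) {n : ℤ}
    (hn : ∀ t, ψ (t + 1) = ψ t + n * (2 * Real.pi)) (Z : Finset ℝ)
    (hZ : ∀ t, t ∈ Z ↔ t ∈ Set.Ico (0 : ℝ) 1 ∧ Real.cos (ψ t) = 0)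
    (hd : ∀ t ∈ Z, deriv ψ t ≠ 0) :
    ∑ t ∈ Z, (SignType.sign (deriv ψ t) : ℤ) = 2 * n := by
  have hpi := Real.pi_pos
  let f : ℝ → ℝ := fun t => ψ t / Real.pi + 1 / 2
  have hf : Differentiable ℝ f := (hψ.div_const _).add_const _
  have hdf : ∀ t, deriv f t = deriv ψ t / Real.pi := by
    intro t
    simp [f]
  have hsign : ∀ t, SignType.sign (deriv f t) = SignType.sign (deriv ψ t) := by
    intro t
    rw [hdf, div_eq_mul_inv, sign_mul, sign_pos (inv_pos.2 hpi), mul_one]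
  have hf1 : ∀ t, f (t + 1) = f t + ((2 * n : ℤ) : ℝ) := by
    intro t
    simp only [f, hn]
    push_cast
    field_simp
    ring
  have hcos : ∀ t, Real.cos (ψ t) = 0 ↔ ∃ k : ℤ, f t = k := fun t =>
    cos_eq_zero_iff_exists_int _
  have hcos1 : ∀ t, Real.cos (ψ (t + 1)) = 0 ↔ Real.cos (ψ t) = 0 := by
    intro t
    rw [hn, Real.cos_add_int_mul_two_pi]
  have hfin : ∀ᶠ a in nhdsWithin (1 : ℝ) (Set.Iio 1), ∀ z ∈ Z, z < a := by
    rw [Filter.eventually_all_finset]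
    exact fun z hz => nhdsWithin_le_nhds (lt_mem_nhds ((hZ z).1 hz).1.2)
  -- The parameter `0` may itself be a zero, so the period is shifted to `[b - 1, b]`, with `b < 1`
  -- beyond all zeros in `[0, 1)`.
  obtain ⟨b, hb, hb1, hb0⟩ := (hfin.and (Filter.Eventually.and self_mem_nhdsWithin
    (nhdsWithin_le_nhds (lt_mem_nhds (zero_lt_one' ℝ))))).exists
  replace hb1 : b < 1 := hb1
  have nb : ∀ t, b ≤ t → t < 1 → Real.cos (ψ t) ≠ 0 := by
    intro t h1 h2 h3
    exact absurd (hb t ((hZ t).2 ⟨⟨hb0.le.trans h1, h2⟩, h3⟩)) h1.not_gt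
  have key := sum_sign_eq_floor_sub_floor hf Z (a := b - 1) (b := b) (by linarith) ?_ ?_ ?_ ?_
  · simp only [hsign] at key
    rw [key]
    have := hf1 (b - 1)
    rw [sub_add_cancel] at this
    rw [this, Int.floor_add_intCast]
    ring
  · intro k e
    refine nb b le_rfl hb1 ?_
    have := (hcos (b - 1)).2 ⟨k, e⟩
    rwa [← hcos1, sub_add_cancel] at this
  · intro k e
    exact nb b le_rfl hb1 ((hcos b).2 ⟨k, e⟩)
  · intro t
    rw [hZ, ← hcos]
    constructor
    · rintro ⟨h1, h2⟩
      exact ⟨⟨by linarith [h1.1], hb t ((hZ t).2 ⟨h1, h2⟩)⟩, h2⟩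
    · rintro ⟨h1, h2⟩
      refine ⟨⟨?_, h1.2.trans hb1⟩, h2⟩
      by_contra hneg
      exact nb (t + 1) (by linarith [h1.1]) (by linarith) ((hcos1 t).2 h2)
  · intro t ht
    rw [hdf]
    exact div_ne_zero (hd t ht) hpi.ne'

/-! ### Parametrized circles and pairs of ellipses -/

/-- A smooth regular injective parametrization `(C, S)` of the unit circle, of period `1`. -/
structure IsCircleParam (C S : ℝ → ℝ) : Prop where
  smooth_fst : ContDiff ℝ ∞ C
  smooth_snd : ContDiff ℝ ∞ S
  periodic_fst : Function.Periodic C 1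
  periodic_snd : Function.Periodic S 1
  unit : ∀ t, C t ^ 2 + S t ^ 2 = 1
  immersed : ∀ t, deriv C t = 0 → deriv S t ≠ 0
  injective : ∀ s t, C s = C t → S s = S t → ∃ n : ℤ, t = s + n

/-- If the degree were at least `2`, the value `θ 0 + 2π` would already be attained strictly inside
the period, at the same point of the circle as `0`. -/
theorem int_eq_one_of_injective_angle {θ : ℝ → ℝ} (hθ : Continuous θ) (hm : StrictMono θ) {n : ℤ}
    (hn : ∀ t, θ (t + 1) = θ t + n * (2 * Real.pi))
    (inj : ∀ s t, ∀ k : ℤ, θ t = θ s + k * (2 * Real.pi) → ∃ m : ℤ, t = s + m) : n = 1 := by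
  have hpi := Real.pi_pos
  have h01 : θ 0 < θ (0 + 1) := hm (by norm_num)
  rw [hn 0] at h01
  have hn0 : (0 : ℝ) < n := by
    by_contra h
    nlinarith [not_lt.1 h]
  have hn1 : 1 ≤ n := by exact_mod_cast hn0
  by_contra hne
  have hn2 : (2 : ℝ) ≤ n := by exact_mod_cast (by omega : 2 ≤ n)
  obtain ⟨t, ht, e⟩ := intermediate_value_Icc (zero_le_one' ℝ) hθ.continuousOn
    (show θ 0 + 2 * Real.pi ∈ Set.Icc (θ 0) (θ 1) by
      have := hn 0
      rw [zero_add] at this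
      rw [this]
      constructor <;> nlinarith)
  obtain ⟨m, hm'⟩ := inj 0 t 1 (by rw [e]; simp)
  have ht1 : t < 1 := by
    refine lt_of_le_of_ne ht.2 ?_
    rintro rfl
    have := hn 0
    rw [zero_add] at this
    nlinarith
  have ht0 : 0 < t := by
    refine lt_of_le_of_ne ht.1 ?_
    rintro rfl
    linarith
  rw [zero_add] at hm'
  subst hm'
  have h1 : (0 : ℤ) < m := by exact_mod_cast ht0
  have h2 : m < (1 : ℤ) := by exact_mod_cast ht1
  omega

theorem cos_sin_eq_iff {a b : ℝ} (hc : Real.cos a = Real.cos b) (hs : Real.sin a = Real.sin b) :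
    ∃ k : ℤ, b = a + k * (2 * Real.pi) := by
  have ha := Real.Angle.cos_sin_inj hc.symm hs.symm
  obtain ⟨k, hk⟩ := Real.Angle.angle_eq_iff_two_pi_dvd_sub.mp ha
  exact ⟨k, by linarith⟩

/-- The derivative of a lifted angle never vanishes, hence has constant sign, and injectivity forces
degree `±1`. The sign `e` mirrors clockwise parametrizations. -/
theorem IsCircleParam.exists_angle {C S : ℝ → ℝ} (h : IsCircleParam C S) :
    ∃ e : ℝ, (e = 1 ∨ e = -1) ∧ ∃ θ : ℝ → ℝ, ContDiff ℝ ∞ θ ∧ (∀ t, 0 < deriv θ t) ∧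
      (∀ t, θ (t + 1) = θ t + 2 * Real.pi) ∧ (∀ t, Real.cos (θ t) = C t) ∧
      ∀ t, Real.sin (θ t) = e * S t := by
  let γ : ℝ → ℂ := fun t => (C t : ℂ) + (S t : ℂ) * Complex.I
  have hC := h.smooth_fst
  have hS := h.smooth_snd
  have ofReal_smooth : ContDiff ℝ ∞ (fun x : ℝ => (x : ℂ)) := Complex.ofRealCLM.contDiff
  have hγ : ContDiff ℝ ∞ γ :=
    (ofReal_smooth.comp hC).add ((ofReal_smooth.comp hS).mul contDiff_const)
  have re : ∀ t, (γ t).re = C t := fun t => by simp [γ]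
  have im : ∀ t, (γ t).im = S t := fun t => by simp [γ]
  have hn1 : ∀ t, ‖γ t‖ = 1 := by
    intro t
    rw [Complex.norm_eq_sqrt_sq_add_sq, re, im, h.unit, Real.sqrt_one]
  have h0 : ∀ t, γ t ≠ 0 := fun t e => by
    have := hn1 t
    rw [e] at this
    simp at this
  obtain ⟨w, hw, he⟩ := exists_smooth_log hγ h0
  have hp : Function.Periodic γ 1 := fun t => by
    simp only [γ, h.periodic_fst t, h.periodic_snd t]
  obtain ⟨n, hn⟩ := exists_int_lift_add_one hw hp he
  let φ : ℝ → ℝ := fun t => (w t).im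
  have hφ : ContDiff ℝ ∞ φ := Complex.imCLM.contDiff.comp hw
  have hre : ∀ t, (w t).re = 0 := by
    intro t
    have := hn1 t
    rw [← he, Complex.norm_exp] at this
    exact Real.exp_eq_one_iff _ |>.1 this
  have hcos : ∀ t, Real.cos (φ t) = C t := by
    intro t
    rw [← re, ← he, Complex.exp_re, hre, Real.exp_zero, one_mul]
  have hsin : ∀ t, Real.sin (φ t) = S t := by
    intro t
    rw [← im, ← he, Complex.exp_im, hre, Real.exp_zero, one_mul]
  have hφn : ∀ t, φ (t + 1) = φ t + n * (2 * Real.pi) := by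
    intro t
    simp [φ, hn]
  have hφd : ∀ t, HasDerivAt φ (deriv φ t) t := fun t =>
    (hφ.differentiable (by simp) t).hasDerivAt
  have hφ0 : ∀ t ∈ Set.univ, deriv φ t ≠ 0 := by
    intro t _ e
    have h1 : deriv C t = 0 := by
      rw [show C = fun t => Real.cos (φ t) from funext fun t => (hcos t).symm, (hφd t).cos.deriv,
        e, mul_zero]
    have h2 : deriv S t = 0 := by
      rw [show S = fun t => Real.sin (φ t) from funext fun t => (hsin t).symm, (hφd t).sin.deriv,
        e, mul_zero]
    exact h.immersed t h1 h2
  have inj : ∀ s t, ∀ k : ℤ, φ t = φ s + k * (2 * Real.pi) → ∃ m : ℤ, t = s + m := by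
    intro s t k e
    apply h.injective
    · rw [← hcos, ← hcos, e, Real.cos_add_int_mul_two_pi]
    · rw [← hsin, ← hsin, e, Real.sin_add_int_mul_two_pi]
  rcases hasDerivWithinAt_forall_lt_or_forall_gt_of_forall_ne convex_univ
    (fun t _ => (hφd t).hasDerivWithinAt) hφ0 with hneg | hpos
  · have hd : ∀ t, HasDerivAt (fun t => -φ t) (-deriv φ t) t := fun t => (hφd t).neg
    have hdp : ∀ t, 0 < deriv (fun t => -φ t) t := fun t => by
      rw [(hd t).deriv]
      exact neg_pos.2 (hneg t trivial)
    have h1 : -n = 1 := by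
      refine int_eq_one_of_injective_angle hφ.continuous.neg (strictMono_of_deriv_pos hdp)
        (fun t => ?_) fun s t k e => inj s t (-k) ?_
      · simp only [Pi.neg_apply, hφn]
        push_cast
        ring
      · simp only [Pi.neg_apply] at e
        push_cast
        linarith
    refine ⟨-1, Or.inr rfl, fun t => -φ t, hφ.neg, hdp, fun t => ?_, fun t => ?_, fun t => ?_⟩
    · have : (n : ℝ) = -1 := by exact_mod_cast (by omega : n = -1)
      simp only [hφn, this]
      ring
    · rw [Real.cos_neg, hcos]
    · rw [Real.sin_neg, hsin, neg_one_mul]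
  · have hdp : ∀ t, 0 < deriv φ t := fun t => hpos t trivial
    have h1 : n = 1 := int_eq_one_of_injective_angle hφ.continuous
      (strictMono_of_deriv_pos hdp) hφn inj
    refine ⟨1, Or.inl rfl, φ, hφ, hdp, fun t => ?_, hcos, fun t => ?_⟩
    · rw [hφn, h1]
      simp
    · rw [hsin, one_mul]

/-- The ellipse with centre `(a, b, c)` and conjugate half-axes `(u, 0, 0)` and `(0, v, w)`. -/
def ellipse (C S : ℝ → ℝ) (a b c u v w : ℝ) (t : ℝ) : Fin 3 → ℝ :=
  ![a + u * C t, b + v * S t, c + w * S t]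

theorem IsCircleParam.isLoop_ellipse {C S : ℝ → ℝ} (h : IsCircleParam C S) (a b c : ℝ)
    {u v w : ℝ} (hu : u ≠ 0) (hvw : v ≠ 0 ∨ w ≠ 0) : IsLoop (ellipse C S a b c u v w) := by
  have hC := h.smooth_fst
  have hS := h.smooth_snd
  refine isLoop_vec3 (by fun_prop) (by fun_prop) (by fun_prop) ?_ ?_ ?_ ?_ ?_
  · intro t
    simp only [h.periodic_fst t]
  · intro t
    simp only [h.periodic_snd t]
  · intro t
    simp only [h.periodic_snd t]
  · intro t h1 h2 h3
    have dS := hS.differentiable (by simp) t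
    have dC := hC.differentiable (by simp) t
    rw [deriv_const_add, deriv_const_mul _ dC] at h1
    rw [deriv_const_add, deriv_const_mul _ dS] at h2 h3
    refine h.immersed t ((mul_eq_zero.1 h1).resolve_left hu) ?_
    rcases hvw with hv | hw
    exacts [(mul_eq_zero.1 h2).resolve_left hv, (mul_eq_zero.1 h3).resolve_left hw]
  · intro s t h1 h2 h3
    refine h.injective s t (mul_left_cancel₀ hu (add_left_cancel h1)) ?_
    rcases hvw with hv | hw
    exacts [mul_left_cancel₀ hv (add_left_cancel h2), mul_left_cancel₀ hw (add_left_cancel h3)]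

theorem IsCircleParam.abs_fst_le {C S : ℝ → ℝ} (h : IsCircleParam C S) (t : ℝ) : |C t| ≤ 1 :=
  abs_le_one_iff_mul_self_le_one.2 (by nlinarith [h.unit t, sq_nonneg (S t)])

theorem isCircleParam_of_angle {θ : ℝ → ℝ} (hθ : ContDiff ℝ ∞ θ) (hd : ∀ t, 0 < deriv θ t)
    (hp : ∀ t, θ (t + 1) = θ t + 2 * Real.pi) :
    IsCircleParam (fun t => Real.cos (θ t)) (fun t => Real.sin (θ t)) where
  smooth_fst := by fun_prop
  smooth_snd := by fun_prop
  periodic_fst t := by simp only [hp, Real.cos_add_two_pi]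
  periodic_snd t := by simp only [hp, Real.sin_add_two_pi]
  unit t := Real.cos_sq_add_sin_sq _
  immersed t h1 h2 := by
    have h := (hθ.differentiable (by simp) t).hasDerivAt
    rw [h.cos.deriv] at h1
    rw [h.sin.deriv] at h2
    have e1 := (mul_eq_zero.1 h1).resolve_right (hd t).ne'
    have e2 := (mul_eq_zero.1 h2).resolve_right (hd t).ne'
    have := Real.sin_sq_add_cos_sq (θ t)
    rw [neg_eq_zero.1 e1, e2] at this
    norm_num at this
  injective s t h1 h2 := by
    have hm : StrictMono θ := strictMono_of_deriv_pos hd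
    obtain ⟨k, hk⟩ := cos_sin_eq_iff h1 h2
    have hk' : ∀ m : ℤ, θ (s + m) = θ s + m * (2 * Real.pi) := by
      intro m
      induction m using Int.induction_on with
      | zero => simp
      | succ i ih =>
        have := hp (s + (i : ℤ))
        push_cast at *
        rw [← add_assoc, this, ih]
        ring
      | pred i ih =>
        have := hp (s + (-(i : ℤ) - 1 : ℤ))
        push_cast at *
        rw [show s + (-(i : ℝ) - 1) + 1 = s + -(i : ℝ) by ring, ih] at this
        linarith
    exact ⟨k, hm.injective (by rw [hk, hk'])⟩

/-- Increasing angles that gain `2π` per period form a convex set, so each can be deformed linearly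
to `2πt` without moving its circle. -/
theorem Link.isUnlink_of_angles {L : Link (Fin 2)} {θ θ' : ℝ → ℝ} (hθ : ContDiff ℝ ∞ θ)
    (hd : ∀ t, 0 < deriv θ t) (hp : ∀ t, θ (t + 1) = θ t + 2 * Real.pi)
    (hθ' : ContDiff ℝ ∞ θ') (hd' : ∀ t, 0 < deriv θ' t)
    (hp' : ∀ t, θ' (t + 1) = θ' t + 2 * Real.pi)
    (hL : L.curve = ![fun t => ![Real.cos (θ t), Real.sin (θ t), 0],
      fun t => ![3 + Real.cos (θ' t), Real.sin (θ' t), 0]]) : L.IsUnlink := by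
  have hpi := Real.pi_pos
  let Θ : (ℝ → ℝ) → ℝ → ℝ → ℝ := fun θ τ t => (1 - τ) * θ t + τ * (2 * Real.pi * t)
  have sΘ : ∀ {θ : ℝ → ℝ}, ContDiff ℝ ∞ θ → ContDiff ℝ ∞ (fun p : ℝ × ℝ => Θ θ p.1 p.2) := by
    intro θ hθ
    simp only [Θ]
    fun_prop
  have param : ∀ {θ : ℝ → ℝ}, ContDiff ℝ ∞ θ → (∀ t, 0 < deriv θ t) →
      (∀ t, θ (t + 1) = θ t + 2 * Real.pi) → ∀ τ ∈ Set.Icc (0 : ℝ) 1,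
      IsCircleParam (fun t => Real.cos (Θ θ τ t)) (fun t => Real.sin (Θ θ τ t)) := by
    intro θ hθ hd hp τ hτ
    refine isCircleParam_of_angle (by simp only [Θ]; fun_prop) (fun t => ?_) fun t => ?_
    · have h := (((hθ.differentiable (by simp) t).hasDerivAt).const_mul (1 - τ)).add
        (((hasDerivAt_id t).const_mul (2 * Real.pi)).const_mul τ)
      have h' : deriv (Θ θ τ) t = (1 - τ) * deriv θ t + τ * (2 * Real.pi * 1) := h.deriv
      rw [h']
      rcases eq_or_lt_of_le hτ.1 with h0 | h0
      · subst h0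
        simpa using hd t
      · have h1 := mul_nonneg (sub_nonneg.2 hτ.2) (hd t).le
        have h2 : 0 < τ * (2 * Real.pi * 1) := by positivity
        linarith
    · simp only [Θ, hp]
      ring
  refine Link.isUnlink_of_family
    (fun τ => ellipse (fun t => Real.cos (Θ θ τ t)) (fun t => Real.sin (Θ θ τ t)) 0 0 0 1 1 0)
    (fun τ => ellipse (fun t => Real.cos (Θ θ' τ t)) (fun t => Real.sin (Θ θ' τ t)) 3 0 0 1 1 0)
    ?_ ?_ ?_ ?_ ?_ ?_ ?_
  · have := sΘ hθ
    exact contDiff_vec3 (by fun_prop) (by fun_prop) (by fun_prop)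
  · have := sΘ hθ'
    exact contDiff_vec3 (by fun_prop) (by fun_prop) (by fun_prop)
  · exact fun τ hτ => (param hθ hd hp τ hτ).isLoop_ellipse _ _ _ (by simp) (by simp)
  · exact fun τ hτ => (param hθ' hd' hp' τ hτ).isLoop_ellipse _ _ _ (by simp) (by simp)
  · intro τ _ s t e
    have := congrFun e 0
    simp only [ellipse, Matrix.cons_val_zero] at this
    linarith [Real.cos_le_one (Θ θ τ s), Real.neg_one_le_cos (Θ θ' τ t)]
  · rw [hL]
    congr 1
    · funext t
      simp [ellipse, Θ]
    · congr 1
      funext t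
      simp [ellipse, Θ]
  · rintro L' hL'
    have : L' = stdUnlink 2 := by
      obtain ⟨c, hc⟩ := L'
      simp only [stdUnlink, Link.mk.injEq]
      simp only at hL'
      rw [hL']
      funext i t
      fin_cases i <;> simp [ellipse, stdCurve, Θ]
    rw [this]
    exact Isotopic.refl _

/-- Two ellipses that are separated by a plane `x = const` form the unlink. -/
theorem Link.isUnlink_of_ellipses {L : Link (Fin 2)} {C S C' S' : ℝ → ℝ} (h : IsCircleParam C S)
    (h' : IsCircleParam C' S') {a b c u v w a' b' c' u' v' w' : ℝ} (hu : 0 < u) (hu' : 0 < u')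
    (hw : w ≠ 0) (hw' : w' ≠ 0) (sep : a + u < a' - u')
    (hL : L.curve = ![ellipse C S a b c u v w, ellipse C' S' a' b' c' u' v' w']) :
    L.IsUnlink := by
  obtain ⟨e, he, θ, hθ, hd, hp, hC, hS⟩ := h.exists_angle
  obtain ⟨e', he', θ', hθ', hd', hp', hC', hS'⟩ := h'.exists_angle
  have sC := h.smooth_fst
  have sS := h.smooth_snd
  have sC' := h'.smooth_fst
  have sS' := h'.smooth_snd
  -- The half-axis in the `y`-direction may vanish on the way from `v` to `e`; the `z`-part `(1 - τ)
  -- * w` keeps the ellipse nondegenerate until `τ = 1`, where the `y`-part is `e = ±1`.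
  have loop : ∀ {C S : ℝ → ℝ} (_ : IsCircleParam C S) {e : ℝ} (_ : e = 1 ∨ e = -1)
      (a b c u v w d : ℝ) (_ : 0 < u) (_ : w ≠ 0), ∀ τ ∈ Set.Icc (0 : ℝ) 1,
      IsLoop (ellipse C S ((1 - τ) * a + τ * d) ((1 - τ) * b) ((1 - τ) * c) ((1 - τ) * u + τ)
        ((1 - τ) * v + τ * e) ((1 - τ) * w)) := by
    intro C S h e he a b c u v w d hu hw τ hτ
    apply h.isLoop_ellipse
    · rcases eq_or_lt_of_le hτ.1 with h0 | h0
      · subst h0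
        simpa using hu.ne'
      · have := mul_nonneg (sub_nonneg.2 hτ.2) hu.le
        exact (by linarith : 0 < (1 - τ) * u + τ).ne'
    · rcases eq_or_lt_of_le hτ.2 with h0 | h0
      · subst h0
        left
        rcases he with rfl | rfl <;> norm_num
      · right
        exact mul_ne_zero (sub_pos.2 h0).ne' hw
  refine Link.isUnlink_of_family
    (fun τ => ellipse C S ((1 - τ) * a + τ * 0) ((1 - τ) * b) ((1 - τ) * c) ((1 - τ) * u + τ)
        ((1 - τ) * v + τ * e) ((1 - τ) * w))
    (fun τ => ellipse C' S' ((1 - τ) * a' + τ * 3) ((1 - τ) * b') ((1 - τ) * c')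
      ((1 - τ) * u' + τ) ((1 - τ) * v' + τ * e') ((1 - τ) * w')) ?_ ?_
    (loop h he a b c u v w 0 hu hw) (loop h' he' a' b' c' u' v' w' 3 hu' hw') ?_ ?_ ?_
  · exact contDiff_vec3 (by fun_prop) (by fun_prop) (by fun_prop)
  · exact contDiff_vec3 (by fun_prop) (by fun_prop) (by fun_prop)
  · intro τ hτ s t E
    have E0 := congrFun E 0
    simp only [ellipse, Matrix.cons_val_zero] at E0
    have h0 : 0 ≤ 1 - τ := sub_nonneg.2 hτ.2
    have b1 := (abs_le.1 (h.abs_fst_le s)).2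
    have b2 := (abs_le.1 (h'.abs_fst_le t)).1
    have p1 : 0 ≤ (1 - τ) * u + τ := add_nonneg (mul_nonneg h0 hu.le) hτ.1
    have p2 : 0 ≤ (1 - τ) * u' + τ := add_nonneg (mul_nonneg h0 hu'.le) hτ.1
    have q1 := mul_le_mul_of_nonneg_left b1 p1
    have q2 := mul_le_mul_of_nonneg_left b2 p2
    -- The gap between the ranges of the `x`-coordinates is affine in `τ`, from the given separation
    -- to `3 - 1 - 1 = 1`.
    have : 0 < (1 - τ) * (a' - u' - (a + u)) + τ := by
      rcases eq_or_lt_of_le hτ.1 with h1 | h1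
      · subst h1
        linarith
      · have := mul_nonneg h0 (sub_pos.2 sep).le
        linarith
    linarith
  · rw [hL]
    simp
  · intro L' hL'
    refine Link.isUnlink_of_angles hθ hd hp hθ' hd' hp' ?_
    rw [hL']
    simp only [hC, hS, hC', hS']
    congr 1
    · funext t
      simp [ellipse]
    · congr 1
      funext t
      simp [ellipse]

theorem periodic_add_int {α : Type*} {f : ℝ → α} (h : Function.Periodic f 1) (t : ℝ) (n : ℤ) :
    f (t + n) = f t := by
  simpa using h.int_mul n t

theorem exists_int_add_mem_Ico (a s : ℝ) : ∃ n : ℤ, ∃ s₀ ∈ Set.Ico a (a + 1), s = s₀ + n := by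
  refine ⟨⌊s - a⌋, s - ⌊s - a⌋, ⟨?_, ?_⟩, by ring⟩
  · linarith [Int.floor_le (s - a)]
  · linarith [Int.lt_floor_add_one (s - a)]

/-! ### The height profile: one rise and one fall per period -/

section Profile

/-- The common denominator of `bumpCos` and `bumpSin`. -/
noncomputable def bumpDen (a b t : ℝ) : ℝ :=
  Real.sin (Real.pi * (t - a)) ^ 2 + Real.sin (Real.pi * (t - b)) ^ 2

/-- The first coordinate of the circle parametrization `(bumpCos a b, bumpSin a b)`: it is
negative between `a` and `b` and positive between `b` and `a + 1`. -/
noncomputable def bumpCos (a b t : ℝ) : ℝ :=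
  2 * Real.sin (Real.pi * (t - a)) * Real.sin (Real.pi * (t - b)) / bumpDen a b t

/-- The second coordinate of the circle parametrization `(bumpCos a b, bumpSin a b)`: it rises
from `a` to `b` and falls from `b` to `a + 1`. -/
noncomputable def bumpSin (a b t : ℝ) : ℝ :=
  (Real.sin (Real.pi * (t - a)) ^ 2 - Real.sin (Real.pi * (t - b)) ^ 2) / bumpDen a b t

variable {a b : ℝ}

theorem sin_gap_pos (hab : a < b) (hb : b < a + 1) : 0 < Real.sin (Real.pi * (b - a)) := by
  have := Real.pi_pos
  apply Real.sin_pos_of_pos_of_lt_pi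
  · exact mul_pos this (sub_pos.2 hab)
  · nlinarith

/-- Up to the factor `π`, this is the Wronskian of the two sines. It is a nonzero constant when `a <
b < a + 1`, so they have no common zero. -/
theorem sin_mul_cos_sub (a b t : ℝ) :
    Real.sin (Real.pi * (t - a)) * Real.cos (Real.pi * (t - b)) -
      Real.cos (Real.pi * (t - a)) * Real.sin (Real.pi * (t - b)) =
      Real.sin (Real.pi * (b - a)) := by
  rw [← Real.sin_sub]
  congr 1
  ring

theorem bumpDen_pos (hab : a < b) (hb : b < a + 1) (t : ℝ) : 0 < bumpDen a b t := by
  have h := sin_gap_pos hab hb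
  rw [← sin_mul_cos_sub a b t] at h
  unfold bumpDen
  by_contra hn
  have h1 : Real.sin (Real.pi * (t - a)) = 0 := by
    nlinarith [sq_nonneg (Real.sin (Real.pi * (t - a))), sq_nonneg (Real.sin (Real.pi * (t - b)))]
  have h2 : Real.sin (Real.pi * (t - b)) = 0 := by
    nlinarith [sq_nonneg (Real.sin (Real.pi * (t - a))), sq_nonneg (Real.sin (Real.pi * (t - b)))]
  simp [h1, h2] at h

theorem hasDerivAt_sin_pi_mul (a t : ℝ) : HasDerivAt (fun t => Real.sin (Real.pi * (t - a)))
    (Real.pi * Real.cos (Real.pi * (t - a))) t := by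
  have := (((hasDerivAt_id t).sub_const a).const_mul Real.pi).sin
  refine this.congr_deriv ?_
  simp [mul_comm]

/-- If `A` and `B` are the two sines, `(2AB, A² - B²) / (A² + B²)` is the direction of the plane
curve `(A, B)` with its angle doubled, which turns antiperiodicity into period `1`. It moves on the
unit circle with speed twice the Wronskian over `A² + B²`. -/
theorem hasDerivAt_bumpSin (hab : a < b) (hb : b < a + 1) (t : ℝ) :
    HasDerivAt (bumpSin a b)
      (-(2 * Real.pi * Real.sin (Real.pi * (b - a)) / bumpDen a b t) * bumpCos a b t) t := by
  have hA := hasDerivAt_sin_pi_mul a t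
  have hB := hasDerivAt_sin_pi_mul b t
  have hne := (bumpDen_pos hab hb t).ne'
  refine (((hA.pow 2).sub (hB.pow 2)).div ((hA.pow 2).add (hB.pow 2)) hne).congr_deriv ?_
  rw [← sin_mul_cos_sub a b t]
  simp only [bumpCos]
  simp only [bumpDen, Pi.add_apply, Pi.sub_apply, Pi.pow_apply] at hne ⊢
  field_simp
  ring

theorem hasDerivAt_bumpCos (hab : a < b) (hb : b < a + 1) (t : ℝ) :
    HasDerivAt (bumpCos a b)
      (2 * Real.pi * Real.sin (Real.pi * (b - a)) / bumpDen a b t * bumpSin a b t) t := by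
  have hA := hasDerivAt_sin_pi_mul a t
  have hB := hasDerivAt_sin_pi_mul b t
  have hne := (bumpDen_pos hab hb t).ne'
  refine (((hA.const_mul 2).mul hB).div ((hA.pow 2).add (hB.pow 2)) hne).congr_deriv ?_
  rw [← sin_mul_cos_sub a b t]
  simp only [bumpSin]
  simp only [bumpDen, Pi.add_apply, Pi.pow_apply, Pi.mul_apply] at hne ⊢
  field_simp
  ring

theorem bump_sq_add_sq (hab : a < b) (hb : b < a + 1) (t : ℝ) :
    bumpCos a b t ^ 2 + bumpSin a b t ^ 2 = 1 := by
  have hne := (bumpDen_pos hab hb t).ne'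
  simp only [bumpCos, bumpSin]
  field_simp
  unfold bumpDen
  ring

theorem contDiff_bumpDen : ContDiff ℝ ∞ (bumpDen a b) := by
  unfold bumpDen
  fun_prop

theorem contDiff_bumpCos (hab : a < b) (hb : b < a + 1) : ContDiff ℝ ∞ (bumpCos a b) :=
  ContDiff.div (by fun_prop) contDiff_bumpDen fun t => (bumpDen_pos hab hb t).ne'

theorem contDiff_bumpSin (hab : a < b) (hb : b < a + 1) : ContDiff ℝ ∞ (bumpSin a b) :=
  ContDiff.div (by fun_prop) contDiff_bumpDen fun t => (bumpDen_pos hab hb t).ne'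

theorem sin_pi_mul_add_one (a t : ℝ) :
    Real.sin (Real.pi * (t + 1 - a)) = -Real.sin (Real.pi * (t - a)) := by
  rw [← Real.sin_add_pi]
  congr 1
  ring

theorem periodic_bumpCos : Function.Periodic (bumpCos a b) 1 := fun t => by
  simp only [bumpCos, bumpDen, sin_pi_mul_add_one]
  ring

theorem periodic_bumpSin : Function.Periodic (bumpSin a b) 1 := fun t => by
  simp only [bumpSin, bumpDen, sin_pi_mul_add_one]
  ring

theorem bumpCos_neg (hab : a < b) (hb : b < a + 1) {t : ℝ} (ht : t ∈ Set.Ioo a b) :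
    bumpCos a b t < 0 := by
  have hpi := Real.pi_pos
  have h1 : 0 < Real.sin (Real.pi * (t - a)) :=
    Real.sin_pos_of_pos_of_lt_pi (mul_pos hpi (by linarith [ht.1])) (by nlinarith [ht.2])
  have h2 : Real.sin (Real.pi * (t - b)) < 0 :=
    Real.sin_neg_of_neg_of_neg_pi_lt (mul_neg_of_pos_of_neg hpi (by linarith [ht.2]))
      (by nlinarith [ht.1])
  exact div_neg_of_neg_of_pos (mul_neg_of_pos_of_neg (by positivity) h2) (bumpDen_pos hab hb t)

theorem bumpCos_pos (hab : a < b) (hb : b < a + 1) {t : ℝ} (ht : t ∈ Set.Ioo b (a + 1)) :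
    0 < bumpCos a b t := by
  have hpi := Real.pi_pos
  have h1 : 0 < Real.sin (Real.pi * (t - a)) :=
    Real.sin_pos_of_pos_of_lt_pi (mul_pos hpi (by linarith [ht.1])) (by nlinarith [ht.2])
  have h2 : 0 < Real.sin (Real.pi * (t - b)) :=
    Real.sin_pos_of_pos_of_lt_pi (mul_pos hpi (by linarith [ht.1])) (by nlinarith [ht.2])
  exact div_pos (by positivity) (bumpDen_pos hab hb t)

theorem bumpCos_left : bumpCos a b a = 0 := by simp [bumpCos]

theorem bumpCos_right : bumpCos a b b = 0 := by simp [bumpCos]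

theorem bumpCos_nonpos (hab : a < b) (hb : b < a + 1) {t : ℝ} (ht : t ∈ Set.Icc a b) :
    bumpCos a b t ≤ 0 := by
  rcases eq_or_lt_of_le ht.1 with h | h
  · rw [← h, bumpCos_left]
  rcases eq_or_lt_of_le ht.2 with h' | h'
  · rw [h', bumpCos_right]
  · exact (bumpCos_neg hab hb ⟨h, h'⟩).le

theorem exists_int_of_bumpCos_eq_zero (hab : a < b) (hb : b < a + 1) {t : ℝ}
    (h : bumpCos a b t = 0) : ∃ n : ℤ, t = a + n ∨ t = b + n := by
  obtain ⟨n, s, hs, rfl⟩ := exists_int_add_mem_Ico a t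
  rw [periodic_add_int periodic_bumpCos] at h
  refine ⟨n, ?_⟩
  rcases lt_trichotomy s b with h1 | h1 | h1
  · rcases eq_or_lt_of_le hs.1 with h2 | h2
    · left; rw [h2]
    · exact absurd h (bumpCos_neg hab hb ⟨h2, h1⟩).ne
  · right; rw [h1]
  · exact absurd h (bumpCos_pos hab hb ⟨h1, hs.2⟩).ne'

theorem bumpSin_left (hab : a < b) (hb : b < a + 1) : bumpSin a b a = -1 := by
  have h := bumpDen_pos hab hb a
  simp only [bumpSin, bumpDen, sub_self, mul_zero, Real.sin_zero] at h ⊢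
  rw [div_eq_iff h.ne']
  ring

theorem bumpSin_right (hab : a < b) (hb : b < a + 1) : bumpSin a b b = 1 := by
  have h := bumpDen_pos hab hb b
  simp only [bumpSin, bumpDen, sub_self, mul_zero, Real.sin_zero] at h ⊢
  rw [div_eq_iff h.ne']
  ring

theorem abs_bumpSin_le (hab : a < b) (hb : b < a + 1) (t : ℝ) : |bumpSin a b t| ≤ 1 :=
  abs_le_one_iff_mul_self_le_one.2 (by nlinarith [bump_sq_add_sq hab hb t, sq_nonneg (bumpCos a b t)])

theorem bumpSpeed_pos (hab : a < b) (hb : b < a + 1) (t : ℝ) :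
    0 < 2 * Real.pi * Real.sin (Real.pi * (b - a)) / bumpDen a b t :=
  div_pos (mul_pos (by have := Real.pi_pos; positivity) (sin_gap_pos hab hb))
    (bumpDen_pos hab hb t)

theorem strictMonoOn_bumpSin (hab : a < b) (hb : b < a + 1) :
    StrictMonoOn (bumpSin a b) (Set.Icc a b) := by
  refine strictMonoOn_of_deriv_pos (convex_Icc a b)
    (contDiff_bumpSin hab hb).continuous.continuousOn fun t ht => ?_
  rw [interior_Icc] at ht
  rw [(hasDerivAt_bumpSin hab hb t).deriv]
  exact mul_pos_of_neg_of_neg (neg_neg_of_pos (bumpSpeed_pos hab hb t)) (bumpCos_neg hab hb ht)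

theorem strictAntiOn_bumpSin (hab : a < b) (hb : b < a + 1) :
    StrictAntiOn (bumpSin a b) (Set.Icc b (a + 1)) := by
  refine strictAntiOn_of_deriv_neg (convex_Icc b (a + 1))
    (contDiff_bumpSin hab hb).continuous.continuousOn fun t ht => ?_
  rw [interior_Icc] at ht
  rw [(hasDerivAt_bumpSin hab hb t).deriv]
  exact mul_neg_of_neg_of_pos (neg_neg_of_pos (bumpSpeed_pos hab hb t)) (bumpCos_pos hab hb ht)

/-- On each of the two monotone arcs the height determines the time; the values of `g` on either
side of `m` tell the arcs apart. -/
theorem bumpSin_injective_with (hab : a < b) (hb : b < a + 1) {g : ℝ → ℝ} {m : ℝ}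
    (hg : Function.Periodic g 1) (hin : ∀ t ∈ Set.Icc a b, m ≤ g t)
    (hout : ∀ t ∈ Set.Ioo b (a + 1), g t < m) {s t : ℝ} (hs : bumpSin a b s = bumpSin a b t)
    (he : g s = g t) : ∃ n : ℤ, t = s + n := by
  obtain ⟨k, s, hk, rfl⟩ := exists_int_add_mem_Ico a s
  obtain ⟨l, t, hl, rfl⟩ := exists_int_add_mem_Ico a t
  simp only [periodic_add_int periodic_bumpSin, periodic_add_int hg] at hs he
  have : s = t := by
    rcases le_or_gt s b with h1 | h1 <;> rcases le_or_gt t b with h2 | h2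
    · exact (strictMonoOn_bumpSin hab hb).injOn ⟨hk.1, h1⟩ ⟨hl.1, h2⟩ hs
    · linarith [hin s ⟨hk.1, h1⟩, hout t ⟨h2, hl.2⟩]
    · linarith [hin t ⟨hl.1, h2⟩, hout s ⟨h1, hk.2⟩]
    · exact (strictAntiOn_bumpSin hab hb).injOn ⟨h1.le, hk.2.le⟩ ⟨h2.le, hl.2.le⟩ hs
  subst this
  exact ⟨l - k, by push_cast; ring⟩

theorem isCircleParam_bump (hab : a < b) (hb : b < a + 1) :
    IsCircleParam (bumpCos a b) (bumpSin a b) where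
  smooth_fst := contDiff_bumpCos hab hb
  smooth_snd := contDiff_bumpSin hab hb
  periodic_fst := periodic_bumpCos
  periodic_snd := periodic_bumpSin
  unit := bump_sq_add_sq hab hb
  immersed t h1 h2 := by
    rw [(hasDerivAt_bumpCos hab hb t).deriv] at h1
    rw [(hasDerivAt_bumpSin hab hb t).deriv] at h2
    have := (bumpSpeed_pos hab hb t).ne'
    have e1 := (mul_eq_zero.1 h1).resolve_left this
    have e2 := (mul_eq_zero.1 h2).resolve_left (neg_ne_zero.2 this)
    have := bump_sq_add_sq hab hb t
    rw [e1, e2] at this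
    norm_num at this
  injective s t h1 h2 := by
    refine bumpSin_injective_with hab hb (g := fun t => -bumpCos a b t) (m := 0)
      (fun t => by simp only [periodic_bumpCos t]) (fun t ht => ?_) (fun t ht => ?_) h2 (by rw [h1])
    · exact neg_nonneg.2 (bumpCos_nonpos hab hb ht)
    · exact neg_neg_of_pos (bumpCos_pos hab hb ht)

end Profile

/-! ### Farthest points of closed plane curves -/

/-- Otherwise the point would also be a local minimum and `f` would be locally constant. -/
theorem deriv_deriv_nonpos_of_isLocalMax {f : ℝ → ℝ} {b : ℝ} (hf : ContDiff ℝ ∞ f)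
    (h : IsLocalMax f b) : deriv (deriv f) b ≤ 0 := by
  by_contra! hpos
  have hmin := isLocalMin_of_deriv_deriv_pos hpos h.deriv_eq_zero hf.continuous.continuousAt
  have hconst : f =ᶠ[nhds b] fun _ => f b := by
    filter_upwards [h, hmin] with t h1 h2 using le_antisymm h1 h2
  have := hconst.deriv.deriv_eq
  simp at this
  exact hpos.ne' this

/-- Near `b` the function is strictly concave; away from `b`, by compactness and uniqueness, it is
at most some `D c < D b`. The level halfway between `D c` and `D b` cuts out an arc as short as
desired. -/
theorem exists_superlevel_interval {D : ℝ → ℝ} (hD : ContDiff ℝ ∞ D) (hp : Function.Periodic D 1)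
    {b : ℝ} (h2 : deriv (deriv D) b < 0) (hle : ∀ t, D t ≤ D b)
    (huniq : ∀ t, D t = D b → ∃ n : ℤ, t = b + n) {δ : ℝ} (hδ : 0 < δ) :
    ∃ t₀ t₁ l, b - δ < t₀ ∧ t₀ < b ∧ b < t₁ ∧ t₁ < b + δ ∧ t₁ < t₀ + 1 ∧
      (∀ t ∈ Set.Icc t₀ t₁, l ≤ D t) ∧ (∀ t ∈ Set.Ioo t₁ (t₀ + 1), D t < l) ∧
      0 < deriv D t₀ ∧ deriv D t₁ < 0 := by
  have hc := hD.continuous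
  have hD1 : ContDiff ℝ ∞ (deriv D) := (contDiff_infty_iff_deriv.1 hD).2
  have hD2 : ContDiff ℝ ∞ (deriv (deriv D)) := (contDiff_infty_iff_deriv.1 hD1).2
  have h1 : deriv D b = 0 := IsLocalMax.deriv_eq_zero (Filter.Eventually.of_forall hle)
  obtain ⟨ε, hε, hneg⟩ := Metric.eventually_nhds_iff.1
    (hD2.continuous.continuousAt.eventually (gt_mem_nhds h2))
  obtain ⟨η, hη, hηε, hηδ, hη3⟩ : ∃ η, 0 < η ∧ η < ε ∧ η < δ ∧ η < 1 / 3 :=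
    ⟨min (min ε δ) (1 / 3) / 2, by positivity, by
      linarith [min_le_left (min ε δ) (1 / 3), min_le_left ε δ, lt_min (lt_min hε hδ) (by norm_num : (0:ℝ) < 1 / 3)], by
      linarith [min_le_left (min ε δ) (1 / 3), min_le_right ε δ, lt_min (lt_min hε hδ) (by norm_num : (0:ℝ) < 1 / 3)], by
      linarith [min_le_right (min ε δ) (1 / 3)]⟩
  have anti : StrictAntiOn (deriv D) (Set.Icc (b - η) (b + η)) := by
    refine strictAntiOn_of_deriv_neg (convex_Icc _ _) hD1.continuous.continuousOn fun t ht => ?_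
    rw [interior_Icc] at ht
    refine hneg ?_
    rw [Real.dist_eq, abs_lt]
    constructor <;> linarith [ht.1, ht.2]
  have dpos : ∀ t, b - η ≤ t → t < b → 0 < deriv D t := fun t l u => by
    rw [← h1]
    exact anti ⟨l, by linarith⟩ ⟨by linarith, by linarith⟩ u
  have dneg : ∀ t, b < t → t ≤ b + η → deriv D t < 0 := fun t l u => by
    rw [← h1]
    exact anti ⟨by linarith, by linarith⟩ ⟨by linarith, u⟩ l
  have mono : StrictMonoOn D (Set.Icc (b - η) b) := by
    refine strictMonoOn_of_deriv_pos (convex_Icc _ _) hc.continuousOn fun t ht => ?_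
    rw [interior_Icc] at ht
    exact dpos t ht.1.le ht.2
  have manti : StrictAntiOn D (Set.Icc b (b + η)) := by
    refine strictAntiOn_of_deriv_neg (convex_Icc _ _) hc.continuousOn fun t ht => ?_
    rw [interior_Icc] at ht
    exact dneg t ht.1 ht.2.le
  obtain ⟨c, hcm, hmax⟩ := isCompact_Icc.exists_isMaxOn
    (Set.nonempty_Icc.2 (by linarith : b + η ≤ b + 1 - η)) hc.continuousOn
  have hcb : D c < D b := by
    refine lt_of_le_of_ne (hle c) fun e => ?_
    obtain ⟨n, rfl⟩ := huniq c e
    have l : (0 : ℝ) < n := by linarith [hcm.1]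
    have u : (n : ℝ) < 1 := by linarith [hcm.2]
    have l' : 0 < n := by exact_mod_cast l
    have u' : n < 1 := by exact_mod_cast u
    omega
  have hmax' : ∀ t ∈ Set.Icc (b + η) (b + 1 - η), D t ≤ D c := fun t ht => hmax ht
  have e0 : D (b - η) ≤ D c := by
    rw [← hp (b - η)]
    exact hmax' _ ⟨by linarith, by linarith⟩
  have e1 : D (b + η) ≤ D c := hmax' _ ⟨le_rfl, by linarith⟩
  obtain ⟨t₀, ht₀, el₀⟩ := intermediate_value_Ioo (by linarith : b - η ≤ b) hc.continuousOn
    (show (D c + D b) / 2 ∈ Set.Ioo (D (b - η)) (D b) by constructor <;> linarith)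
  obtain ⟨t₁, ht₁, el₁⟩ := intermediate_value_Ioo' (by linarith : b ≤ b + η) hc.continuousOn
    (show (D c + D b) / 2 ∈ Set.Ioo (D (b + η)) (D b) by constructor <;> linarith)
  refine ⟨t₀, t₁, (D c + D b) / 2, by linarith [ht₀.1], ht₀.2, ht₁.1, by linarith [ht₁.2],
    by linarith [ht₀.1, ht₁.2], ?_, ?_, dpos t₀ ht₀.1.le ht₀.2, dneg t₁ ht₁.1 ht₁.2.le⟩
  · intro t ht
    rcases le_total t b with h | h
    · rw [← el₀]
      exact mono.monotoneOn ⟨ht₀.1.le, ht₀.2.le⟩ ⟨ht₀.1.le.trans ht.1, h⟩ ht.1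
    · rw [← el₁]
      exact manti.antitoneOn ⟨h, ht.2.trans ht₁.2.le⟩ ⟨ht₁.1.le, ht₁.2.le⟩ ht.2
  · intro t ht
    rcases le_total t (b + η) with h | h
    · rw [← el₁]
      exact manti ⟨ht₁.1.le, ht₁.2.le⟩ ⟨ht₁.1.le.trans ht.1.le, h⟩ ht.1
    rcases le_total t (b + 1 - η) with h' | h'
    · linarith [hmax' t ⟨h, h'⟩]
    · have hp' : D t = D (t - 1) := by
        have := hp (t - 1)
        rwa [sub_add_cancel] at this
      rw [← el₀, hp']
      exact mono ⟨by linarith, by linarith [ht.2, ht₀.2]⟩ ⟨ht₀.1.le, ht₀.2.le⟩ (by linarith [ht.2])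

/-- The squared distance of the point `(x t, y t)` of a plane curve from `(c, d)`. -/
def sqDist (x y : ℝ → ℝ) (c d t : ℝ) : ℝ := (x t - c) ^ 2 + (y t - d) ^ 2

section PlaneCurve

variable {x y : ℝ → ℝ}

theorem contDiff_sqDist (hx : ContDiff ℝ ∞ x) (hy : ContDiff ℝ ∞ y) (c d : ℝ) :
    ContDiff ℝ ∞ (sqDist x y c d) := by
  unfold sqDist
  fun_prop

theorem periodic_sqDist (px : Function.Periodic x 1) (py : Function.Periodic y 1) (c d : ℝ) :
    Function.Periodic (sqDist x y c d) 1 := fun t => by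
  simp only [sqDist, px t, py t]

theorem hasDerivAt_sqDist (hx : ContDiff ℝ ∞ x) (hy : ContDiff ℝ ∞ y) (c d t : ℝ) :
    HasDerivAt (sqDist x y c d) (2 * ((x t - c) * deriv x t + (y t - d) * deriv y t)) t := by
  have dx := (hx.differentiable (by simp) t).hasDerivAt
  have dy := (hy.differentiable (by simp) t).hasDerivAt
  refine (((dx.sub_const c).pow 2).add ((dy.sub_const d).pow 2)).congr_deriv ?_
  simp
  ring

theorem deriv_deriv_sqDist (hx : ContDiff ℝ ∞ x) (hy : ContDiff ℝ ∞ y) (c d t : ℝ) :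
    deriv (deriv (sqDist x y c d)) t = 2 * (deriv x t ^ 2 + deriv y t ^ 2 +
      (x t - c) * deriv (deriv x) t + (y t - d) * deriv (deriv y) t) := by
  have dx := (hx.differentiable (by simp) t).hasDerivAt
  have dy := (hy.differentiable (by simp) t).hasDerivAt
  have ddx := ((contDiff_infty_iff_deriv.1 hx).2.differentiable (by simp) t).hasDerivAt
  have ddy := ((contDiff_infty_iff_deriv.1 hy).2.differentiable (by simp) t).hasDerivAt
  rw [show deriv (sqDist x y c d) = _ from funext fun t => (hasDerivAt_sqDist hx hy c d t).deriv]
  refine HasDerivAt.deriv ((((dx.sub_const c).mul ddx).add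
    ((dy.sub_const d).mul ddy)).const_mul 2 |>.congr_deriv ?_)
  ring

theorem exists_farthest (hx : ContDiff ℝ ∞ x) (hy : ContDiff ℝ ∞ y) (px : Function.Periodic x 1)
    (py : Function.Periodic y 1) (c d : ℝ) : ∃ b, ∀ t, sqDist x y c d t ≤ sqDist x y c d b := by
  obtain ⟨b, _, hb⟩ := isCompact_Icc.exists_isMaxOn (Set.nonempty_Icc.2 (zero_le_one' ℝ))
    (contDiff_sqDist hx hy c d).continuous.continuousOn
  refine ⟨b, fun t => ?_⟩
  obtain ⟨n, s, hs, rfl⟩ := exists_int_add_mem_Ico 0 t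
  rw [periodic_add_int (periodic_sqDist px py c d)]
  exact hb ⟨hs.1, by linarith [hs.2]⟩

/-- A transverse closed plane curve passes only once through a point at maximal distance from a
given point. -/
theorem planarDet_eq_zero_of_farthest (hx : ContDiff ℝ ∞ x) (hy : ContDiff ℝ ∞ y) {c d b s t : ℝ}
    (hb : ∀ t, sqDist x y c d t ≤ sqDist x y c d b) (h0 : 0 < sqDist x y c d b)
    (hsx : x s = x b) (hsy : y s = y b) (htx : x t = x b) (hty : y t = y b) :
    deriv x s * deriv y t - deriv y s * deriv x t = 0 := by
  have crit : ∀ s, x s = x b → y s = y b →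
      (x b - c) * deriv x s + (y b - d) * deriv y s = 0 := by
    intro s h1 h2
    have hmax : IsLocalMax (sqDist x y c d) s := Filter.Eventually.of_forall fun t => by
      have : sqDist x y c d s = sqDist x y c d b := by simp only [sqDist, h1, h2]
      rw [this]
      exact hb t
    have := hmax.deriv_eq_zero
    rw [(hasDerivAt_sqDist hx hy c d s).deriv, h1, h2] at this
    linarith
  have h1 := crit s hsx hsy
  have h2 := crit t htx hty
  -- Both velocities are perpendicular to the same nonzero radius, hence parallel.
  have e : sqDist x y c d b * (deriv x s * deriv y t - deriv y s * deriv x t) = 0 := by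
    unfold sqDist
    linear_combination ((x b - c) * deriv y t - (y b - d) * deriv x t) * h1 +
      (-(x b - c) * deriv y s + (y b - d) * deriv x s) * h2
  exact (mul_eq_zero.1 e).resolve_left h0.ne'

/-- Near a point where it is immersed, a plane curve is injective. -/
theorem exists_injOn_near (hx : ContDiff ℝ ∞ x) (hy : ContDiff ℝ ∞ y) {b : ℝ}
    (him : deriv x b ≠ 0 ∨ deriv y b ≠ 0) : ∃ δ > 0, ∀ s ∈ Set.Icc (b - δ) (b + δ),
      ∀ t ∈ Set.Icc (b - δ) (b + δ), x s = x t → y s = y t → s = t := by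
  -- The projection to the tangent direction at `b` is strictly increasing near `b`.
  let g : ℝ → ℝ := fun t => deriv x b * x t + deriv y b * y t
  have hg : ContDiff ℝ ∞ g := by
    simp only [g]
    fun_prop
  have hg1 : Continuous (deriv g) := ((contDiff_infty_iff_deriv.1 hg).2).continuous
  have hpos : 0 < deriv g b := by
    have dx := (hx.differentiable (by simp) b).hasDerivAt
    have dy := (hy.differentiable (by simp) b).hasDerivAt
    have dg : HasDerivAt g (deriv x b * deriv x b + deriv y b * deriv y b) b :=
      (dx.const_mul (deriv x b)).add (dy.const_mul (deriv y b))
    rw [dg.deriv]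
    rcases him with h | h
    · nlinarith [mul_self_pos.2 h, mul_self_nonneg (deriv y b)]
    · nlinarith [mul_self_pos.2 h, mul_self_nonneg (deriv x b)]
  obtain ⟨ε, hε, h⟩ := Metric.eventually_nhds_iff.1
    (hg1.continuousAt.eventually (lt_mem_nhds hpos))
  have mono : StrictMonoOn g (Set.Icc (b - ε / 2) (b + ε / 2)) := by
    refine strictMonoOn_of_deriv_pos (convex_Icc _ _) hg.continuous.continuousOn fun t ht => ?_
    rw [interior_Icc] at ht
    refine h ?_
    rw [Real.dist_eq, abs_lt]
    constructor <;> linarith [ht.1, ht.2]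
  exact ⟨ε / 2, by positivity, fun s hs t ht e1 e2 => mono.injOn hs ht (by simp only [g, e1, e2])⟩

/-- Moving the centre away from a farthest point `b` of a closed curve makes `b` the unique
farthest point, in a nondegenerate way. -/
theorem exists_arc_near_farthest (hx : ContDiff ℝ ∞ x) (hy : ContDiff ℝ ∞ y)
    (px : Function.Periodic x 1) (py : Function.Periodic y 1) {c d b l δ : ℝ}
    (hb : ∀ t, sqDist x y c d t ≤ sqDist x y c d b) (him : deriv x b ≠ 0 ∨ deriv y b ≠ 0)
    (huniq : ∀ t, x t = x b → y t = y b → ∃ n : ℤ, t = b + n) (hl : 0 < l) (hδ : 0 < δ) :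
    ∃ t₀ t₁ m, b - δ < t₀ ∧ t₀ < b ∧ b < t₁ ∧ t₁ < b + δ ∧ t₁ < t₀ + 1 ∧
      (∀ t ∈ Set.Icc t₀ t₁, m ≤ sqDist x y (c - l * (x b - c)) (d - l * (y b - d)) t) ∧
      (∀ t ∈ Set.Ioo t₁ (t₀ + 1), sqDist x y (c - l * (x b - c)) (d - l * (y b - d)) t < m) ∧
      0 < deriv (sqDist x y (c - l * (x b - c)) (d - l * (y b - d))) t₀ ∧
      deriv (sqDist x y (c - l * (x b - c)) (d - l * (y b - d))) t₁ < 0 := by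
  set c' := c - l * (x b - c) with hc'
  set d' := d - l * (y b - d) with hd'
  -- The first term is nonnegative as `b` was farthest already. The second vanishes only at the
  -- point of `b` and makes the second derivative at `b` strictly negative.
  have ident : ∀ t, sqDist x y c' d' b - sqDist x y c' d' t =
      (1 + l) * (sqDist x y c d b - sqDist x y c d t) + l * ((x t - x b) ^ 2 + (y t - y b) ^ 2) := by
    intro t
    simp only [sqDist, hc', hd']
    ring
  have pos : ∀ t, 0 ≤ (1 + l) * (sqDist x y c d b - sqDist x y c d t) := fun t =>
    mul_nonneg (by linarith) (sub_nonneg.2 (hb t))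
  have pos' : ∀ t, 0 ≤ l * ((x t - x b) ^ 2 + (y t - y b) ^ 2) := fun t => by positivity
  refine exists_superlevel_interval (contDiff_sqDist hx hy c' d') (periodic_sqDist px py c' d')
    ?_ (fun t => by linarith [ident t, pos t, pos' t]) (fun t e => ?_) hδ
  · have h2 := deriv_deriv_nonpos_of_isLocalMax (contDiff_sqDist hx hy c d)
      (Filter.Eventually.of_forall hb : IsLocalMax _ b)
    rw [deriv_deriv_sqDist hx hy] at h2 ⊢
    have hN : 0 < deriv x b ^ 2 + deriv y b ^ 2 := by
      rcases him with h | h <;> positivity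
    have := mul_pos hl hN
    have h3 := mul_nonpos_of_nonneg_of_nonpos (by linarith : 0 ≤ 1 + l) h2
    have e : 2 * (deriv x b ^ 2 + deriv y b ^ 2 + (x b - c') * deriv (deriv x) b +
        (y b - d') * deriv (deriv y) b) = (1 + l) * (2 * (deriv x b ^ 2 + deriv y b ^ 2 +
        (x b - c) * deriv (deriv x) b + (y b - d) * deriv (deriv y) b)) -
        2 * (l * (deriv x b ^ 2 + deriv y b ^ 2)) := by
      rw [hc', hd']
      ring
    linarith
  · have h1 : l * ((x t - x b) ^ 2 + (y t - y b) ^ 2) = 0 := by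
      linarith [ident t, pos t, pos' t]
    have h2 := (mul_eq_zero.1 h1).resolve_left hl.ne'
    refine huniq t ?_ ?_ <;> nlinarith [sq_nonneg (x t - x b), sq_nonneg (y t - y b)]

end PlaneCurve

/-! ### Isotopy of a descending curve and a steep circle to the unlink -/

theorem periodic_deriv {f : ℝ → ℝ} (h : Function.Periodic f 1) : Function.Periodic (deriv f) 1 := by
  intro t
  rw [← deriv_comp_add_const, show (fun t => f (t + 1)) = f from funext h]

/-- A compact family of plane curves that avoids the leftmost and rightmost points of a family
of circles meets the circles at a height bounded away from that of their centres. -/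
theorem exists_tilt {kx ky : ℝ → ℝ → ℝ} {p q r : ℝ → ℝ}
    (hkx : Continuous (fun a : ℝ × ℝ => kx a.1 a.2))
    (hky : Continuous (fun a : ℝ × ℝ => ky a.1 a.2))
    (px : ∀ τ, Function.Periodic (kx τ) 1) (py : ∀ τ, Function.Periodic (ky τ) 1)
    (hp : Continuous p) (hq : Continuous q) (hr : Continuous r)
    (left : ∀ τ ∈ Set.Icc (0 : ℝ) 1, ∀ t, kx τ t = p τ - r τ → ky τ t ≠ q τ)
    (right : ∀ τ ∈ Set.Icc (0 : ℝ) 1, ∀ t, kx τ t = p τ + r τ → ky τ t ≠ q τ) :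
    ∃ M₀, ∀ M ≥ M₀, ∀ τ ∈ Set.Icc (0 : ℝ) 1, ∀ t,
      (kx τ t - p τ) ^ 2 + (ky τ t - q τ) ^ 2 = r τ ^ 2 → 1 < M * |ky τ t - q τ| := by
  let T : Set (ℝ × ℝ) := Set.Icc (0 : ℝ) 1 ×ˢ Set.Icc (0 : ℝ) 1 ∩
    {a | (kx a.1 a.2 - p a.1) ^ 2 + (ky a.1 a.2 - q a.1) ^ 2 = r a.1 ^ 2}
  have hT : IsCompact T := (isCompact_Icc.prod isCompact_Icc).inter_right
    (isClosed_eq (by fun_prop) (by fun_prop))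
  obtain ⟨m, hm, hle⟩ := hT.exists_forall_le' (a := 0) (f := fun a => |ky a.1 a.2 - q a.1|)
    (by fun_prop) (by
      rintro ⟨τ, t⟩ ⟨⟨hτ, -⟩, hc⟩
      simp only [Set.mem_ofPred_eq] at hc hτ ⊢
      rw [abs_pos, sub_ne_zero]
      intro e
      -- A point of the circle at the height of its centre in the page is its leftmost or its
      -- rightmost point.
      have h2 : (kx τ t - (p τ - r τ)) * (kx τ t - (p τ + r τ)) = 0 := by
        rw [e] at hc
        linear_combination hc
      rcases mul_eq_zero.1 h2 with h | h
      · exact left τ hτ t (sub_eq_zero.1 h) e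
      · exact right τ hτ t (sub_eq_zero.1 h) e)
  refine ⟨2 / m, fun M hM τ hτ t hc => ?_⟩
  obtain ⟨n, s, hs, rfl⟩ := exists_int_add_mem_Ico 0 t
  rw [periodic_add_int (px τ), periodic_add_int (py τ)] at hc
  rw [periodic_add_int (py τ)]
  have h1 := hle (τ, s) ⟨⟨hτ, hs.1, by linarith [hs.2]⟩, hc⟩
  have h2 : 2 ≤ M * m := (div_le_iff₀ hm).1 hM
  have h3 : 0 < M := (div_pos two_pos hm).trans_le hM
  have h4 := mul_le_mul_of_nonneg_left h1 h3.le
  simp only at h4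
  linarith

/-- Where `K` lies over or under the tilted circle, the latter has height of absolute value `M * |K
1 - q| > 1`, out of reach of `K`. -/
theorem ne_tilted_circle {K : Fin 3 → ℝ} {C S : ℝ → ℝ} (h : IsCircleParam C S) {p q r ε M t : ℝ}
    (hε : |ε| = 1) (hM : 0 ≤ M) (hK : |K 2| ≤ 1)
    (tilt : (K 0 - p) ^ 2 + (K 1 - q) ^ 2 = r ^ 2 → 1 < M * |K 1 - q|) :
    K ≠ ellipse C S p q 0 r r (-(ε * M * r)) t := by
  intro e
  have e0 : K 0 = p + r * C t := congrFun e 0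
  have e1 : K 1 = q + r * S t := congrFun e 1
  have e2 : K 2 = 0 + -(ε * M * r) * S t := congrFun e 2
  have h1 := tilt (by rw [e0, e1]; linear_combination r ^ 2 * h.unit t)
  have h2 : |K 2| = M * |K 1 - q| := by
    rw [e2, e1, show 0 + -(ε * M * r) * S t = -(ε * (M * (q + r * S t - q))) by ring, abs_neg,
      abs_mul, hε, one_mul, abs_mul, abs_of_nonneg hM]
  linarith

/-- A curve that rises on an arc which lies farther than the rest from a vertical line, descends
otherwise, and does not wind around this line, forms the unlink with a steep round circle. -/
theorem isUnlink_of_descending {x y ρ φ C S : ℝ → ℝ} {p q r dx dy E m a b σ ε : ℝ}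
    (hx : ContDiff ℝ ∞ x) (hy : ContDiff ℝ ∞ y) (px : Function.Periodic x 1)
    (py : Function.Periodic y 1) (him : ∀ t, deriv x t ≠ 0 ∨ deriv y t ≠ 0)
    (hCS : IsCircleParam C S) (hab : a < b) (hb : b < a + 1) (hσ : |σ| = 1) (hε : |ε| = 1)
    (hr : 0 < r) (hE : 0 ≤ E) (hE' : 3 / 2 < 2 * (r + E))
    (inj : ∀ s t, x s = x t → y s = y t → bumpSin a b s = bumpSin a b t → ∃ n : ℤ, t = s + n)
    (left : ∀ τ ∈ Set.Icc (0 : ℝ) 1, ∀ t, x t = p - r + τ * dx → y t ≠ q + τ * dy)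
    (right : ∀ τ ∈ Set.Icc (0 : ℝ) 1, ∀ t, x t = p + r + τ * dx + 2 * τ * E → y t ≠ q + τ * dy)
    (hρ : ContDiff ℝ ∞ ρ) (hφ : ContDiff ℝ ∞ φ) (pρ : Function.Periodic ρ 1)
    (pφ : Function.Periodic φ 1) (ρpos : ∀ t, 0 < ρ t) (ρlt : ∀ t, ρ t < 2 * (r + E))
    (ex : ∀ t, x t = p - r + dx + ρ t * Real.cos (φ t))
    (ey : ∀ t, y t = q + dy + ρ t * Real.sin (φ t))
    (hin : ∀ t ∈ Set.Icc a b, m ≤ ρ t) (hout : ∀ t ∈ Set.Ioo b (a + 1), ρ t < m)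
    (da : 0 < deriv ρ a) (db : deriv ρ b < 0) :
    ∃ M : ℝ, (∀ t, (x t - p) ^ 2 + (y t - q) ^ 2 = r ^ 2 → 1 < M * |y t - q|) ∧
      IsLink ![fun t => ![x t, y t, σ * bumpSin a b t],
        ellipse C S p q 0 r r (-(ε * M * r))] ∧
      ∀ L : Link (Fin 2), L.curve = ![fun t => ![x t, y t, σ * bumpSin a b t],
        ellipse C S p q 0 r r (-(ε * M * r))] → L.IsUnlink := by
  have hσ0 : σ ≠ 0 := by
    rintro rfl
    simp at hσ
  have hε0 : ε ≠ 0 := by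
    rintro rfl
    simp at hε
  have sC := hCS.smooth_fst
  have sS := hCS.smooth_snd
  have sc := contDiff_bumpCos hab hb
  have ss := contDiff_bumpSin hab hb
  have bnd : ∀ t, |σ * bumpSin a b t| ≤ 1 := fun t => by
    rw [abs_mul, hσ, one_mul]
    exact abs_bumpSin_le hab hb t
  -- The contraction of the curve in polar coordinates around `(p - r + dx, q + dy)`. It ends at
  -- angle `π` with radius between `1/2` and `3/2`, larger on the rising arc.
  let R : ℝ → ℝ → ℝ := fun τ t => (1 - τ) * ρ t + τ * (1 - bumpCos a b t / 2)
  let Φ : ℝ → ℝ → ℝ := fun τ t => (1 - τ) * φ t + τ * Real.pi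
  let X : ℝ → ℝ → ℝ := fun τ t => p - r + dx + R τ t * Real.cos (Φ τ t)
  let Y : ℝ → ℝ → ℝ := fun τ t => q + dy + R τ t * Real.sin (Φ τ t)
  have sR : ContDiff ℝ ∞ (fun w : ℝ × ℝ => R w.1 w.2) := by
    simp only [R]
    fun_prop
  have sΦ : ContDiff ℝ ∞ (fun w : ℝ × ℝ => Φ w.1 w.2) := by
    simp only [Φ]
    fun_prop
  have sX : ContDiff ℝ ∞ (fun w : ℝ × ℝ => X w.1 w.2) := by
    simp only [X]
    fun_prop
  have sY : ContDiff ℝ ∞ (fun w : ℝ × ℝ => Y w.1 w.2) := by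
    simp only [Y]
    fun_prop
  have pair : ∀ τ : ℝ, ContDiff ℝ ∞ (fun t : ℝ => (τ, t)) := fun τ => by fun_prop
  have sRτ : ∀ τ, ContDiff ℝ ∞ (R τ) := fun τ => sR.comp (pair τ)
  have sXτ : ∀ τ, ContDiff ℝ ∞ (X τ) := fun τ => sX.comp (pair τ)
  have sYτ : ∀ τ, ContDiff ℝ ∞ (Y τ) := fun τ => sY.comp (pair τ)
  have pR : ∀ τ, Function.Periodic (R τ) 1 := fun τ t => by
    simp only [R, pρ t, periodic_bumpCos t]
  have pX : ∀ τ, Function.Periodic (X τ) 1 := fun τ t => by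
    simp only [X, Φ, pR τ t, pφ t]
  have pY : ∀ τ, Function.Periodic (Y τ) 1 := fun τ t => by
    simp only [Y, Φ, pR τ t, pφ t]
  have bc : ∀ t, |bumpCos a b t| ≤ 1 := (isCircleParam_bump hab hb).abs_fst_le
  have Rpos : ∀ τ ∈ Set.Icc (0 : ℝ) 1, ∀ t, 0 < R τ t := by
    intro τ hτ t
    have h1 := mul_nonneg (sub_nonneg.2 hτ.2) (ρpos t).le
    have h2 : 1 / 2 ≤ 1 - bumpCos a b t / 2 := by linarith [(abs_le.1 (bc t)).2]
    have h3 := mul_le_mul_of_nonneg_left h2 hτ.1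
    simp only [R]
    rcases eq_or_lt_of_le hτ.1 with h0 | h0
    · subst h0
      simpa using ρpos t
    · linarith
  have Rlt : ∀ τ ∈ Set.Icc (0 : ℝ) 1, ∀ t, R τ t < 2 * (r + E) := by
    intro τ hτ t
    have h1 := mul_le_mul_of_nonneg_left (ρlt t).le (sub_nonneg.2 hτ.2)
    have h2 : 1 - bumpCos a b t / 2 ≤ 3 / 2 := by linarith [(abs_le.1 (bc t)).1]
    have h3 := mul_le_mul_of_nonneg_left h2 hτ.1
    simp only [R]
    rcases eq_or_lt_of_le hτ.1 with h0 | h0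
    · subst h0
      simpa using ρlt t
    · have := mul_lt_mul_of_pos_left hE' h0
      linarith
  have sq : ∀ τ t, (X τ t - (p - r + dx)) ^ 2 + (Y τ t - (q + dy)) ^ 2 = R τ t ^ 2 := by
    intro τ t
    simp only [X, Y]
    linear_combination R τ t ^ 2 * Real.cos_sq_add_sin_sq (Φ τ t)
  -- `M₁` serves while the circle grows: its leftmost point moves by `(dx, dy)` and its rightmost
  -- point by an additional `2E` to the right. `M₂` serves while the curve contracts, when `0 < R <
  -- 2 (r + E)` keeps it off both points.
  obtain ⟨M₁, hM₁⟩ := exists_tilt (kx := fun _ => x) (ky := fun _ => y)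
    (p := fun τ => p + τ * (dx + E)) (q := fun τ => q + τ * dy) (r := fun τ => r + τ * E)
    (hx.continuous.comp continuous_snd) (hy.continuous.comp continuous_snd) (fun _ => px)
    (fun _ => py) (by fun_prop) (by fun_prop) (by fun_prop)
    (fun τ hτ t e => left τ hτ t (by rw [e]; ring)) (fun τ hτ t e => right τ hτ t (by rw [e]; ring))
  obtain ⟨M₂, hM₂⟩ := exists_tilt (kx := X) (ky := Y)
    (p := fun _ => p + (dx + E)) (q := fun _ => q + dy) (r := fun _ => r + E)
    sX.continuous sY.continuous pX pY (by fun_prop) (by fun_prop) (by fun_prop)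
    (fun τ hτ t e e' => by
      have h1 := sq τ t
      rw [e, e'] at h1
      nlinarith [Rpos τ hτ t])
    (fun τ hτ t e e' => by
      have h1 := sq τ t
      rw [e, e'] at h1
      nlinarith [Rpos τ hτ t, Rlt τ hτ t])
  let M := max (max M₁ M₂) 1
  have hM1 : M₁ ≤ M := (le_max_left _ _).trans (le_max_left _ _)
  have hM2 : M₂ ≤ M := (le_max_right _ _).trans (le_max_left _ _)
  have hM0 : 1 ≤ M := le_max_right _ _
  have hM0' : (0 : ℝ) ≤ M := by linarith
  have loopK : IsLoop (fun t => ![x t, y t, σ * bumpSin a b t]) := by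
    refine isLoop_vec3 hx hy (by fun_prop) px py (fun t => by simp only [periodic_bumpSin t])
      (fun t h1 h2 => ?_) fun s t h1 h2 h3 => inj s t h1 h2 (mul_left_cancel₀ hσ0 h3)
    rcases him t with h | h
    exacts [absurd h1 h, absurd h2 h]
  have loopU : ∀ τ ∈ Set.Icc (0 : ℝ) 1, IsLoop (ellipse C S (p + τ * (dx + E)) (q + τ * dy) 0
      (r + τ * E) (r + τ * E) (-(ε * M * (r + τ * E)))) := by
    intro τ hτ
    have : 0 < r + τ * E := add_pos_of_pos_of_nonneg hr (mul_nonneg hτ.1 hE)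
    exact hCS.isLoop_ellipse _ _ _ this.ne' (Or.inl this.ne')
  have disj₁ : ∀ τ ∈ Set.Icc (0 : ℝ) 1, ∀ s t, ![x s, y s, σ * bumpSin a b s] ≠
      ellipse C S (p + τ * (dx + E)) (q + τ * dy) 0
      (r + τ * E) (r + τ * E) (-(ε * M * (r + τ * E))) t := fun τ hτ s t =>
    ne_tilted_circle hCS hε hM0' (bnd s) (hM₁ M hM1 τ hτ s)
  have loopR : ∀ τ ∈ Set.Icc (0 : ℝ) 1, IsLoop (fun t => ![X τ t, Y τ t, σ * bumpSin a b t]) := by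
    intro τ hτ
    have h0 : 0 ≤ 1 - τ := sub_nonneg.2 hτ.2
    refine isLoop_vec3 (sXτ τ) (sYτ τ) (by fun_prop) (pX τ) (pY τ)
      (fun t => by simp only [periodic_bumpSin t]) ?_ ?_
    -- A vanishing velocity would make both height and radius stationary. The height is stationary
    -- only at the ends `a` and `b` of the rise, up to periods, where the radius strictly increases
    -- and strictly decreases, respectively, throughout the contraction.
    · intro t h1 h2 h3
      have dR : ∀ t, HasDerivAt (R τ) (deriv (R τ) t) t := fun t =>
        ((sRτ τ).differentiable (by simp) t).hasDerivAt
      have e1 := hasDerivAt_sqDist (sXτ τ) (sYτ τ) (p - r + dx) (q + dy) t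
      rw [show sqDist (X τ) (Y τ) (p - r + dx) (q + dy) = fun t => R τ t ^ 2 from
        funext (sq τ), h1, h2] at e1
      have e2 := e1.unique ((dR t).pow 2)
      have e3 : deriv (R τ) t = 0 := by
        have : R τ t * deriv (R τ) t = 0 := by
          norm_num at e2
          rcases e2 with h | h
          · rw [h, zero_mul]
          · rw [h, mul_zero]
        exact (mul_eq_zero.1 this).resolve_left (Rpos τ hτ t).ne'
      have dS := hasDerivAt_bumpSin hab hb t
      rw [(dS.const_mul σ).deriv] at h3
      have e4 := (mul_eq_zero.1 ((mul_eq_zero.1 h3).resolve_left hσ0)).resolve_left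
        (neg_ne_zero.2 (bumpSpeed_pos hab hb t).ne')
      have Rderiv : ∀ t, deriv (R τ) t = (1 - τ) * deriv ρ t + τ * (-(2 * Real.pi *
          Real.sin (Real.pi * (b - a)) / bumpDen a b t * bumpSin a b t / 2)) := fun t =>
        ((((hρ.differentiable (by simp) t).hasDerivAt).const_mul (1 - τ)).add
          ((((hasDerivAt_bumpCos hab hb t).div_const 2).const_sub 1).const_mul τ)).deriv
      obtain ⟨n, rfl | rfl⟩ := exists_int_of_bumpCos_eq_zero hab hb e4
      · rw [periodic_add_int (periodic_deriv (pR τ)), Rderiv, bumpSin_left hab hb] at e3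
        have sp := bumpSpeed_pos hab hb a
        rcases eq_or_lt_of_le hτ.1 with h | h
        · subst h
          linarith
        · have := mul_nonneg h0 da.le
          have := mul_pos h sp
          linarith
      · rw [periodic_add_int (periodic_deriv (pR τ)), Rderiv, bumpSin_right hab hb] at e3
        have sp := bumpSpeed_pos hab hb b
        rcases eq_or_lt_of_le hτ.1 with h | h
        · subst h
          linarith
        · have := mul_nonneg h0 (neg_pos.2 db).le
          have := mul_pos h sp
          linarith
    · intro s t h1 h2 h3
      -- The level separating the radii of the two arcs is interpolated along with the radius, from
      -- `m` to `1`.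
      refine bumpSin_injective_with hab hb (g := R τ) (m := (1 - τ) * m + τ) (pR τ)
        (fun t ht => ?_) (fun t ht => ?_) (mul_left_cancel₀ hσ0 h3) ?_
      · have e1 := mul_le_mul_of_nonneg_left (hin t ht) h0
        have e2 := mul_nonpos_of_nonneg_of_nonpos hτ.1 (bumpCos_nonpos hab hb ht)
        simp only [R]
        linarith
      · have e2 := mul_nonneg hτ.1 (bumpCos_pos hab hb ht).le
        simp only [R]
        rcases eq_or_lt_of_le hτ.1 with h | h
        · subst h
          linarith [hout t ht]
        · have e1 := mul_le_mul_of_nonneg_left (hout t ht).le h0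
          have e3 := mul_pos h (bumpCos_pos hab hb ht)
          linarith
      · have := sq τ s
        rw [h1, h2, sq τ t] at this
        exact (pow_left_inj₀ (Rpos τ hτ s).le (Rpos τ hτ t).le two_ne_zero).1 this.symm
  refine ⟨M, fun t ht => ?_, ?_, fun L hL => ?_⟩
  · have := hM₁ M hM1 0 (by simp) t
    simp only [zero_mul, add_zero] at this
    exact this ht
  · have h1 := loopU 0 (by simp)
    have h2 := disj₁ 0 (by simp)
    simp only [zero_mul, add_zero] at h1 h2
    exact isLink_pair loopK h1 h2
  · refine Link.isUnlink_of_family (fun _ t => ![x t, y t, σ * bumpSin a b t])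
      (fun τ => ellipse C S (p + τ * (dx + E)) (q + τ * dy) 0
      (r + τ * E) (r + τ * E) (-(ε * M * (r + τ * E)))) ?_ ?_ (fun _ _ => loopK) loopU disj₁ ?_ ?_
    · exact contDiff_vec3 (by fun_prop) (by fun_prop) (by fun_prop)
    · exact contDiff_vec3 (by fun_prop) (by fun_prop) (by fun_prop)
    · rw [hL]
      simp
    · intro L' hL'
      have hU := loopU 1 (by simp)
      simp only [one_mul] at hL' hU
      refine Link.isUnlink_of_family (fun τ t => ![X τ t, Y τ t, σ * bumpSin a b t])
        (fun _ => ellipse C S (p + (dx + E)) (q + dy) 0 (r + E) (r + E) (-(ε * M * (r + E))))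
        ?_ ?_ loopR (fun _ _ => hU) ?_ ?_ ?_
      · exact contDiff_vec3 sX sY (by fun_prop)
      · exact contDiff_vec3 (by fun_prop) (by fun_prop) (by fun_prop)
      · exact fun τ hτ s t => ne_tilted_circle hCS hε hM0' (bnd s) (hM₂ M hM2 τ hτ s)
      · rw [hL']
        congr 1
        funext t
        simp [X, Y, R, Φ, ex, ey]
      · intro L'' hL''
        -- At angle `π` the curve is an ellipse in the vertical plane `y = q + dy`, with largest
        -- `x`-coordinate `1/2` to the left of the circle.
        refine Link.isUnlink_of_ellipses (isCircleParam_bump hab hb) hCS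
          (a := p - r + dx - 1) (b := q + dy) (c := 0) (u := 1 / 2) (v := 0) (w := σ)
          (a' := p + (dx + E)) (b' := q + dy) (c' := 0) (u' := r + E) (v' := r + E)
          (w' := -(ε * M * (r + E))) (by norm_num) (by linarith) hσ0 ?_ (by linarith) ?_
        · exact neg_ne_zero.2 (mul_ne_zero (mul_ne_zero hε0 (by linarith)) (by linarith))
        · rw [hL'']
          congr 1
          funext t
          simp [X, Y, R, Φ, ellipse]
          ring

/-! ### The linking number as a winding number -/

namespace Link

variable {L : Link (Fin 2)} {p q h r : ℝ}

theorem IsParallelStrandsDiskForm.on_circle (hf : L.IsParallelStrandsDiskForm p q h r) (t : ℝ) :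
    (L.x 1 t - p) ^ 2 + (L.y 1 t - q) ^ 2 = r ^ 2 ∧ L.z 1 t = h := by
  have := Set.mem_range_self (f := L.curve 1) t
  rwa [hf.circle] at this

theorem IsParallelStrandsDiskForm.exists_on_circle (hf : L.IsParallelStrandsDiskForm p q h r)
    {u v : ℝ} (huv : (u - p) ^ 2 + (v - q) ^ 2 = r ^ 2) :
    ∃ t ∈ Set.Ico (0 : ℝ) 1, L.x 1 t = u ∧ L.y 1 t = v := by
  have : ![u, v, h] ∈ Set.range (L.curve 1) := by
    rw [hf.circle]
    exact ⟨huv, rfl⟩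
  obtain ⟨t, ht⟩ := this
  obtain ⟨n, s, hs, rfl⟩ := exists_int_add_mem_Ico 0 t
  rw [periodic_add_int (L.isLink.periodic 1)] at ht
  exact ⟨s, by simpa using hs, congrFun ht 0, congrFun ht 1⟩

theorem IsParallelStrandsDiskForm.injective_circle (hf : L.IsParallelStrandsDiskForm p q h r)
    {s t : ℝ} (hx : L.x 1 s = L.x 1 t) (hy : L.y 1 s = L.y 1 t) : ∃ n : ℤ, t = s + n := by
  refine (L.isLink.injective 1 1 s t ?_).2
  simp only [L.curve_eq_vec3, hx, hy, (hf.on_circle s).2, (hf.on_circle t).2]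

theorem IsParallelStrandsDiskForm.isCircleParam (hf : L.IsParallelStrandsDiskForm p q h r) :
    IsCircleParam (fun t => (L.x 1 t - p) / r) (fun t => (L.y 1 t - q) / r) where
  smooth_fst := by
    have := L.contDiff_x 1
    fun_prop
  smooth_snd := by
    have := L.contDiff_y 1
    fun_prop
  periodic_fst t := by simp only [L.periodic_x 1 t]
  periodic_snd t := by simp only [L.periodic_y 1 t]
  unit t := by
    have := hf.radius_pos.ne'
    have e := (hf.on_circle t).1
    field_simp
    exact e
  immersed t h1 h2 := by
    have := hf.radius_pos.ne'
    simp only [deriv_div_const, deriv_sub_const, div_eq_zero_iff, this, or_false] at h1 h2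
    rcases hf.regular.immersed 1 t with h | h
    exacts [h h1, h h2]
  injective s t h1 h2 := by
    have := hf.radius_pos.ne'
    rw [div_left_inj' this, sub_left_inj] at h1 h2
    exact hf.injective_circle h1 h2

theorem IsParallelStrandsDiskForm.exists_sign (hf : L.IsParallelStrandsDiskForm p q h r) :
    ∃ ε : ℝ, (ε = 1 ∨ ε = -1) ∧ ∀ t, (L.x 0 t - p) ^ 2 + (L.y 0 t - q) ^ 2 = r ^ 2 →
      0 < ε * ((L.y 0 t - q) * (L.z 0 t - h)) := by
  rcases hf.through with h1 | h1
  · exact ⟨1, Or.inl rfl, fun t ht => by simpa using h1 t ht⟩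
  · exact ⟨-1, Or.inr rfl, fun t ht => by simpa using h1 t ht⟩

theorem IsParallelStrandsDiskForm.avoids (hf : L.IsParallelStrandsDiskForm p q h r) {t : ℝ}
    (hy : L.y 0 t = q) : L.x 0 t ≠ p - r ∧ L.x 0 t < p + r := by
  refine ⟨fun hx => ?_, hf.left t hy⟩
  obtain ⟨ε, -, he⟩ := hf.exists_sign
  have := he t (by rw [hx, hy]; ring)
  simp [hy] at this

theorem IsParallelStrandsDiskForm.finite_crossings (hf : L.IsParallelStrandsDiskForm p q h r) :
    {t | t ∈ Set.Ico (0 : ℝ) 1 ∧ (L.x 0 t - p) ^ 2 + (L.y 0 t - q) ^ 2 = r ^ 2}.Finite := by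
  refine Set.Finite.of_finite_image (f := L.proj 0) (hf.regular.finite.subset ?_) ?_
  · rintro P ⟨t, ⟨_, ht⟩, rfl⟩
    obtain ⟨s, _, e1, e2⟩ := hf.exists_on_circle ht
    exact ⟨0, t, 1, s, ⟨fun h => by simpa using h.1, by simp [proj, e1, e2]⟩, rfl⟩
  · rintro t ⟨ht, hc⟩ t' ⟨ht', _⟩ e
    obtain ⟨s, _, e1, e2⟩ := hf.exists_on_circle hc
    have c1 : L.Cross 0 t 1 s := ⟨fun h => by simpa using h.1, by simp [proj, e1, e2]⟩
    have c2 : L.Cross 1 s 0 t' := ⟨fun h => by simpa using h.1, by rw [← c1.2, e]⟩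
    have := hf.regular.no_triple _ _ _ _ _ _ c1 c2
    by_contra hne
    refine this ⟨?_, e⟩
    rintro ⟨_, n, hn⟩
    have a1 : (n : ℝ) < 1 := by linarith [ht.1, ht'.2]
    have a2 : (-1 : ℝ) < n := by linarith [ht.2, ht'.1]
    have a3 : n < 1 := by exact_mod_cast a1
    have a4 : -1 < n := by exact_mod_cast a2
    have : n = 0 := by omega
    subst this
    exact hne (by simpa using hn.symm)

/-- In parallel strands disk form with linking number `0`, the first component does not wind
around the leftmost point of the circle. -/
theorem IsParallelStrandsDiskForm.exists_periodic_log
    (hf : L.IsParallelStrandsDiskForm p q h r) (hlk : L.linkingNumber = 0) :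
    ∃ w : ℝ → ℂ, ContDiff ℝ ∞ w ∧ Function.Periodic w 1 ∧
      ∀ t, Complex.exp (w t) = ⟨L.x 0 t - (p - r), L.y 0 t - q⟩ := by
  have hr := hf.radius_pos
  obtain ⟨ε, hε, hthr⟩ := hf.exists_sign
  have sx := L.contDiff_x 0
  have sy := L.contDiff_y 0
  have dx : ∀ t, HasDerivAt (L.x 0) (deriv (L.x 0) t) t := fun t =>
    (sx.differentiable (by simp) t).hasDerivAt
  have dy : ∀ t, HasDerivAt (L.y 0) (deriv (L.y 0) t) t := fun t =>
    (sy.differentiable (by simp) t).hasDerivAt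
  have mk_eq : ∀ a b : ℝ, (⟨a, b⟩ : ℂ) = (a : ℂ) + (b : ℂ) * Complex.I := fun a b =>
    Complex.mk_eq_add_mul_I a b
  have ofReal_smooth : ContDiff ℝ ∞ (fun x : ℝ => (x : ℂ)) := Complex.ofRealCLM.contDiff
  -- `α` is the position relative to the leftmost point; `β` is the position relative to the
  -- rightmost one, mirrored so that the forbidden half-line becomes the cut of the principal
  -- logarithm.
  let α : ℝ → ℂ := fun t => ⟨L.x 0 t - (p - r), L.y 0 t - q⟩
  let β : ℝ → ℂ := fun t => ⟨p + r - L.x 0 t, L.y 0 t - q⟩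
  have sα : ContDiff ℝ ∞ α := by
    simp only [α, mk_eq]
    exact (ofReal_smooth.comp (sx.sub contDiff_const)).add
      ((ofReal_smooth.comp (sy.sub contDiff_const)).mul contDiff_const)
  have sβ : ContDiff ℝ ∞ β := by
    simp only [β, mk_eq]
    exact (ofReal_smooth.comp (contDiff_const.sub sx)).add
      ((ofReal_smooth.comp (sy.sub contDiff_const)).mul contDiff_const)
  have pα : Function.Periodic α 1 := fun t => by simp only [α, L.periodic_x 0 t, L.periodic_y 0 t]
  have pβ : Function.Periodic β 1 := fun t => by simp only [β, L.periodic_x 0 t, L.periodic_y 0 t]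
  have α0 : ∀ t, α t ≠ 0 := fun t e => by
    have e1 : L.x 0 t - (p - r) = 0 := congrArg Complex.re e
    have e2 : L.y 0 t - q = 0 := congrArg Complex.im e
    exact (hf.avoids (sub_eq_zero.1 e2)).1 (sub_eq_zero.1 e1)
  have βs : ∀ t, β t ∈ Complex.slitPlane := fun t => by
    rw [Complex.mem_slitPlane_iff]
    by_cases e : L.y 0 t = q
    · left
      exact sub_pos.2 (hf.avoids e).2
    · right
      exact sub_ne_zero.2 e
  obtain ⟨w, sw, hw⟩ := exists_smooth_log sα α0
  obtain ⟨n, hn⟩ := exists_int_lift_add_one sw pα hw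
  refine ⟨w, sw, ?_, hw⟩
  suffices n0 : n = 0 by
    intro t
    rw [hn, n0]
    simp
  -- A logarithm of `-αβ`, whose real part `G` vanishes exactly on the circle. As `log β` is
  -- periodic, the angle `ψ` has the same degree `n` as `α`.
  let W : ℝ → ℂ := fun t => w t + Complex.log (β t) + Real.pi * Complex.I
  let G : ℝ → ℝ := fun t => (L.x 0 t - p) ^ 2 + (L.y 0 t - q) ^ 2 - r ^ 2
  have hW : ∀ t, Complex.exp (W t) = ⟨G t, -(2 * r * (L.y 0 t - q))⟩ := by
    intro t
    have hβ0 : β t ≠ 0 := Complex.slitPlane_ne_zero (βs t)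
    simp only [W]
    rw [Complex.exp_add, Complex.exp_add, Complex.exp_pi_mul_I, hw, Complex.exp_log hβ0]
    apply Complex.ext
    · simp only [α, β, Complex.mul_re, Complex.mul_im, Complex.neg_re, Complex.neg_im,
        Complex.one_re, Complex.one_im, G]
      ring
    · simp only [α, β, Complex.mul_re, Complex.mul_im, Complex.neg_re, Complex.neg_im,
        Complex.one_re, Complex.one_im]
      ring
  have dW : Differentiable ℝ W := fun t =>
    ((((sw.differentiable (by simp) t).hasDerivAt).add
      ((sβ.differentiable (by simp) t).hasDerivAt.clog_real (βs t))).add_const _).differentiableAt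
  let ψ : ℝ → ℝ := fun t => (W t).im
  have dψ : ∀ t, HasDerivAt ψ (deriv W t).im t := fun t =>
    Complex.imCLM.hasFDerivAt.comp_hasDerivAt t (dW t).hasDerivAt
  have hre : ∀ t, G t = Real.exp (W t).re * Real.cos (ψ t) := fun t => by
    rw [← Complex.exp_re, hW]
  have hcos : ∀ t, Real.cos (ψ t) = 0 ↔ (L.x 0 t - p) ^ 2 + (L.y 0 t - q) ^ 2 = r ^ 2 := by
    intro t
    have h1 : G t = 0 ↔ Real.cos (ψ t) = 0 := by
      rw [hre]
      simp [Real.exp_ne_zero]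
    rw [← h1]
    exact sub_eq_zero
  have hψ1 : ∀ t, ψ (t + 1) = ψ t + n * (2 * Real.pi) := by
    intro t
    simp only [ψ, W, hn, pβ t]
    simp
    ring
  -- On the circle `exp W` is purely imaginary, so the derivative of its real part `G` involves only
  -- `ψ'`.
  have hradial : ∀ t, (L.x 0 t - p) ^ 2 + (L.y 0 t - q) ^ 2 = r ^ 2 →
      (L.x 0 t - p) * deriv (L.x 0) t + (L.y 0 t - q) * deriv (L.y 0) t =
        r * (L.y 0 t - q) * deriv ψ t := by
    intro t ht
    have h1 : HasDerivAt (fun t => (Complex.exp (W t)).re)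
        (Complex.exp (W t) * deriv W t).re t :=
      Complex.reCLM.hasFDerivAt.comp_hasDerivAt t (dW t).hasDerivAt.cexp
    have h2 := ((((dx t).sub_const p).pow 2).add (((dy t).sub_const q).pow 2)).sub_const (r ^ 2)
    have h3 : (fun t => (Complex.exp (W t)).re) = G := funext fun t => by rw [hW]
    rw [h3] at h1
    have h4 := h1.unique h2
    have h5 : G t = 0 := sub_eq_zero.2 ht
    rw [hW, Complex.mul_re, (dψ t).deriv.symm] at h4
    simp only [h5] at h4
    norm_num at h4
    linarith
  obtain ⟨e, he, θ, sθ, dθ, -, hC, hS⟩ := hf.isCircleParam.exists_angle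
  have hdet : ∀ s t, L.proj 0 s = L.proj 1 t →
      L.planarDet 0 s 1 t = e * (deriv θ t * r * (L.y 0 s - q) * deriv ψ s) := by
    intro s t hst
    have ex : L.x 0 s = L.x 1 t := congrArg Prod.fst hst
    have ey : L.y 0 s = L.y 1 t := congrArg Prod.snd hst
    have e2 : e * e = 1 := by rcases he with rfl | rfl <;> norm_num
    have hθ := (sθ.differentiable (by simp) t).hasDerivAt
    have ux : L.x 1 = fun t => p + r * Real.cos (θ t) := funext fun t => by
      rw [hC]
      field_simp
      ring
    have uy : L.y 1 = fun t => q + r * (e * Real.sin (θ t)) := funext fun t => by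
      rw [hS, ← mul_assoc e, e2]
      field_simp
      ring
    have d1 : deriv (L.x 1) t = r * (-Real.sin (θ t) * deriv θ t) := by
      rw [ux]
      exact ((hθ.cos.const_mul r).const_add p).deriv
    have d2 : deriv (L.y 1) t = r * (e * (Real.cos (θ t) * deriv θ t)) := by
      rw [uy]
      exact (((hθ.sin.const_mul e).const_mul r).const_add q).deriv
    have h1 := hradial s (by rw [ex, ey]; exact (hf.on_circle t).1)
    have x1 : L.x 0 s - p = r * Real.cos (θ t) := by rw [ex, ux]; ring
    have y1 : L.y 0 s - q = r * (e * Real.sin (θ t)) := by rw [ey, uy]; ring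
    have h2 : L.planarDet 0 s 1 t = e * deriv θ t * ((L.x 0 s - p) * deriv (L.x 0) s +
        (L.y 0 s - q) * deriv (L.y 0) s) := by
      unfold planarDet
      rw [d1, d2, x1, y1]
      linear_combination (-deriv (L.y 0) s * r * Real.sin (θ t) * deriv θ t) * e2
    rw [h2, h1]
    ring
  have hcirc : ∀ {s t}, L.proj 0 s = L.proj 1 t →
      (L.x 0 s - p) ^ 2 + (L.y 0 s - q) ^ 2 = r ^ 2 := by
    intro s t hst
    have ex : L.x 0 s = L.x 1 t := congrArg Prod.fst hst
    have ey : L.y 0 s = L.y 1 t := congrArg Prod.snd hst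
    rw [ex, ey]
    exact (hf.on_circle t).1
  -- The factor `y - q` of the planar determinant and the height difference `z - h` combine to a
  -- product of constant sign `ε`, because all strands pass alike; only the sign of `ψ'` varies.
  obtain ⟨k, hk, hsign⟩ : ∃ k : ℤ, k ≠ 0 ∧ ∀ s t, L.proj 0 s = L.proj 1 t →
      L.crossingSign s t = k * SignType.sign (deriv ψ s) := by
    have pos : ∀ s t, L.proj 0 s = L.proj 1 t → L.planarDet 0 s 1 t * (L.z 0 s - L.z 1 t) =
        e * ε * (deriv θ t * r * (ε * ((L.y 0 s - q) * (L.z 0 s - h))) * deriv ψ s) ∧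
        0 < deriv θ t * r * (ε * ((L.y 0 s - q) * (L.z 0 s - h))) := by
      intro s t hst
      have ε2 : ε * ε = 1 := by rcases hε with rfl | rfl <;> norm_num
      refine ⟨?_, mul_pos (mul_pos (dθ t) hr) (hthr s (hcirc hst))⟩
      rw [hdet s t hst, (hf.on_circle t).2]
      linear_combination (-e * deriv θ t * r * (L.y 0 s - q) * deriv ψ s * (L.z 0 s - h)) * ε2
    have heε : e * ε = 1 ∨ e * ε = -1 := by
      rcases he with rfl | rfl <;> rcases hε with rfl | rfl <;> norm_num
    rcases heε with h1 | h1
    · refine ⟨1, one_ne_zero, fun s t hst => ?_⟩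
      obtain ⟨h2, h3⟩ := pos s t hst
      rw [crossingSign, h2, h1, one_mul, sign_mul, sign_pos h3, one_mul, one_mul]
    · refine ⟨-1, by norm_num, fun s t hst => ?_⟩
      obtain ⟨h2, h3⟩ := pos s t hst
      rw [crossingSign, h2, h1, neg_one_mul, Left.sign_neg, sign_mul, sign_pos h3, one_mul,
        neg_one_mul, SignType.coe_neg]
  have hfin := hf.finite_crossings
  have hZ : ∀ t, t ∈ hfin.toFinset ↔ t ∈ Set.Ico (0 : ℝ) 1 ∧ Real.cos (ψ t) = 0 := by
    intro t
    rw [Set.Finite.mem_toFinset, hcos]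
    rfl
  have hcount := sum_sign_eq_two_mul_degree (fun t => (dψ t).differentiableAt) hψ1 hfin.toFinset
    hZ (by
      intro t ht e0
      obtain ⟨_, hc⟩ := (Set.Finite.mem_toFinset hfin).1 ht
      obtain ⟨s, _, e1, e2⟩ := hf.exists_on_circle hc
      have hst : L.proj 0 t = L.proj 1 s := by simp [proj, e1, e2]
      refine hf.regular.transverse 0 t 1 s ⟨fun h => by simpa using h.1, hst⟩ ?_
      rw [hdet t s hst, e0]
      simp)
  have hsum : (∑ᶠ p ∈ {p : ℝ × ℝ | p.1 ∈ Set.Ico (0 : ℝ) 1 ∧ p.2 ∈ Set.Ico (0 : ℝ) 1 ∧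
      L.proj 0 p.1 = L.proj 1 p.2}, (L.crossingSign p.1 p.2 : ℚ)) =
      ∑ᶠ t ∈ {t | t ∈ Set.Ico (0 : ℝ) 1 ∧ (L.x 0 t - p) ^ 2 + (L.y 0 t - q) ^ 2 = r ^ 2},
        ((k * SignType.sign (deriv ψ t) : ℤ) : ℚ) := by
    -- The parameter on the first component determines the one on the circle, so mixed crossings
    -- correspond to the zeros of `cos ψ` in one period.
    refine finsum_mem_eq_of_bijOn Prod.fst ⟨?_, ?_, ?_⟩ ?_
    · rintro ⟨s, t⟩ ⟨h1, _, h3⟩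
      exact ⟨h1, hcirc h3⟩
    · rintro ⟨s, t⟩ ⟨_, h2, h3⟩ ⟨s', t'⟩ ⟨_, h2', h3'⟩ (rfl : s = s')
      have h4 : L.proj 1 t = L.proj 1 t' := h3.symm.trans h3'
      obtain ⟨m, hm⟩ := hf.injective_circle (congrArg Prod.fst h4) (congrArg Prod.snd h4)
      simp only at h2 h2' hm
      have a1 : (m : ℝ) < 1 := by linarith [h2.1, h2'.2]
      have a2 : (-1 : ℝ) < m := by linarith [h2.2, h2'.1]
      have a3 : m < 1 := by exact_mod_cast a1
      have a4 : -1 < m := by exact_mod_cast a2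
      have : m = 0 := by omega
      subst this
      simp [hm]
    · rintro t ⟨h1, h2⟩
      obtain ⟨s, hs, e1, e2⟩ := hf.exists_on_circle h2
      exact ⟨(t, s), ⟨h1, hs, by simp [proj, e1, e2]⟩, rfl⟩
    · rintro ⟨s, t⟩ ⟨_, _, h3⟩
      rw [hsign s t h3]
  have hzero : ((k * (2 * n) : ℤ) : ℚ) = 0 := by
    rw [← hcount, Finset.mul_sum, Int.cast_sum, ← finsum_mem_eq_finite_toFinset_sum _ hfin,
      ← hsum]
    simpa [linkingNumber] using hlk
  have hzero' : k * (2 * n) = 0 := by exact_mod_cast hzero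
  have := (mul_eq_zero.1 hzero').resolve_left hk
  omega

end Link

/-! ### Crossing changes and monotone resolutions -/

namespace Link

variable {ι : Type} {L : Link ι}

theorem Cross.z_ne {i j : ι} {s t : ℝ} (hc : L.Cross i s j t) : L.z i s ≠ L.z j t := by
  intro hz
  refine hc.1 (L.isLink.injective i j s t ?_)
  have hx : L.x i s = L.x j t := congrArg Prod.fst hc.2
  have hy : L.y i s = L.y j t := congrArg Prod.snd hc.2
  simp only [L.curve_eq_vec3, hx, hy, hz]

theorem IsCrossingChange.isotopic {S : Set (ℝ × ℝ)} {L' L'' : Link ι} (hr : L.IsRegular)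
    (h' : L.IsCrossingChange S L') (h'' : L.IsCrossingChange S L'') : Isotopic L' L'' := by
  refine isotopic_of_same_diagram (fun i t => ?_) (fun i t => by rw [h''.proj_eq, h'.proj_eq])
    fun i s j t hc hz => ?_
  · rw [show L'.x i = L.x i from funext fun t => congrArg Prod.fst (h'.proj_eq i t),
      show L'.y i = L.y i from funext fun t => congrArg Prod.snd (h'.proj_eq i t)]
    exact hr.immersed i t
  · have hc' : L.Cross i s j t := ⟨hc.1, by rw [← h'.proj_eq, ← h'.proj_eq, hc.2]⟩
    by_cases hS : L.proj i s ∈ S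
    · rwa [h''.changed i s j t hc' hS, ← h'.changed i s j t hc' hS]
    · rwa [h''.kept i s j t hc' hS, ← h'.kept i s j t hc' hS]

/-- The self-crossings at which the later passage after `b` is over, if `σ = 1`, or under, if
`σ = -1`. -/
def signedChanges (L : Link ι) (i : ι) (b σ : ℝ) : Set (ℝ × ℝ) :=
  {P | ∃ s t, b ≤ s ∧ s < t ∧ t < b + 1 ∧ L.proj i s = P ∧ L.proj i t = P ∧
    σ * L.z i s < σ * L.z i t}

theorem signedChanges_one (L : Link ι) (i : ι) (b : ℝ) :
    L.signedChanges i b 1 = L.descendingChanges i b := by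
  simp [signedChanges, descendingChanges]

theorem signedChanges_neg_one (L : Link ι) (i : ι) (b : ℝ) :
    L.signedChanges i b (-1) = L.ascendingChanges i b := by
  simp [signedChanges, ascendingChanges]

theorem cross_of_lt {i : ι} {b s t : ℝ} (h1 : b ≤ s) (h2 : s < t) (h3 : t < b + 1)
    (h : L.proj i s = L.proj i t) : L.Cross i s i t := by
  refine ⟨?_, h⟩
  rintro ⟨_, n, rfl⟩
  have a1 : (0 : ℝ) < n := by linarith
  have a2 : (n : ℝ) < 1 := by linarith
  have a3 : 0 < n := by exact_mod_cast a1
  have a4 : n < 1 := by exact_mod_cast a2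
  omega

theorem signedChanges_subset (L : Link ι) (i : ι) (b σ : ℝ) :
    L.signedChanges i b σ ⊆ L.selfCrossings i := by
  rintro P ⟨s, t, h1, h2, h3, rfl, e, _⟩
  exact ⟨s, t, cross_of_lt h1 h2 h3 e.symm, rfl⟩

theorem IsRegular.finite_selfCrossings (hr : L.IsRegular) (i : ι) : (L.selfCrossings i).Finite :=
  hr.finite.subset fun _ ⟨s, t, h, e⟩ => ⟨i, s, i, t, h, e⟩

theorem Cross.symm {i j : ι} {s t : ℝ} (h : L.Cross i s j t) : L.Cross j t i s := by
  refine ⟨?_, h.2.symm⟩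
  rintro ⟨rfl, n, rfl⟩
  exact h.1 ⟨rfl, -n, by simp⟩

/-- The two passages through a self-crossing are determined by the crossing. -/
theorem IsRegular.passages_unique (hr : L.IsRegular) {i : ι} {b s t s' t' : ℝ} (h1 : b ≤ s)
    (h2 : s < t) (h3 : t < b + 1) (h1' : b ≤ s') (h2' : s' < t') (h3' : t' < b + 1)
    (e : L.proj i s = L.proj i t) (e' : L.proj i s' = L.proj i t')
    (e'' : L.proj i s = L.proj i s') : s = s' ∧ t = t' := by
  have cross : ∀ {u v}, b ≤ u → u < b + 1 → b ≤ v → v < b + 1 → L.proj i u = L.proj i v →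
      u ≠ v → L.Cross i u i v := by
    intro u v a1 a2 a3 a4 a5 a6
    rcases lt_or_gt_of_ne a6 with h | h
    · exact cross_of_lt a1 h a4 a5
    · exact (cross_of_lt a3 h a2 a5.symm).symm
  have key : ∀ u, b ≤ u → u < b + 1 → L.proj i s = L.proj i u → u = s ∨ u = t := by
    intro u a1 a2 a3
    by_contra! hne
    exact hr.no_triple i s i t i u (cross_of_lt h1 h2 h3 e)
      (cross (by linarith) h3 a1 a2 (e.symm.trans a3) hne.2.symm)
      (cross h1 (by linarith) a1 a2 a3 hne.1.symm)
  rcases key s' h1' (by linarith) e'' with a | a <;>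
    rcases key t' (by linarith) h3' (e''.trans e') with c | c
  · linarith
  · exact ⟨a.symm, c.symm⟩
  · linarith
  · linarith

theorem disjoint_changes (hr : L.IsRegular) (i : ι) (b : ℝ) :
    Disjoint (L.descendingChanges i b) (L.ascendingChanges i b) := by
  rw [Set.disjoint_left]
  rintro P ⟨s, t, h1, h2, h3, e1, e2, hz⟩ ⟨s', t', h1', h2', h3', e1', e2', hz'⟩
  obtain ⟨rfl, rfl⟩ := hr.passages_unique h1 h2 h3 h1' h2' h3' (e1.trans e2.symm)
    (e1'.trans e2'.symm) (e1.trans e1'.symm)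
  linarith

theorem min_ncard_changes_le (hr : L.IsRegular) (i : ι) (b : ℝ) :
    min (L.descendingChanges i b).ncard (L.ascendingChanges i b).ncard ≤
      (L.selfCrossings i).ncard / 2 := by
  have hfin := hr.finite_selfCrossings i
  have h1 : L.descendingChanges i b ⊆ L.selfCrossings i := by
    rw [← signedChanges_one]
    exact signedChanges_subset _ _ _ _
  have h2 : L.ascendingChanges i b ⊆ L.selfCrossings i := by
    rw [← signedChanges_neg_one]
    exact signedChanges_subset _ _ _ _
  have h3 := Set.ncard_union_eq (disjoint_changes hr i b) (hfin.subset h1) (hfin.subset h2)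
  have h4 := Set.ncard_le_ncard (Set.union_subset h1 h2) hfin
  omega

variable {L : Link (Fin 2)} {p q h r : ℝ}

/-- In parallel strands disk form, a link with the same projection, the same crossings between
the components and a first component that is monotone from `b` on arises by changing the
crossings that are not yet monotone. -/
theorem IsParallelStrandsDiskForm.isCrossingChange (hf : L.IsParallelStrandsDiskForm p q h r)
    {b σ : ℝ} (hσ : σ = 1 ∨ σ = -1) {L' : Link (Fin 2)} (hproj : ∀ i t, L'.proj i t = L.proj i t)
    (hmono : ∀ s t, b ≤ s → s < t → t < b + 1 → L.proj 0 s = L.proj 0 t →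
      σ * L'.z 0 t < σ * L'.z 0 s)
    (hmix : ∀ s t, L.proj 0 s = L.proj 1 t → (L'.z 0 s < L'.z 1 t ↔ L.z 0 s < L.z 1 t)) :
    L.IsCrossingChange (L.signedChanges 0 b σ) L' := by
  have c11 : ∀ s t, ¬ L.Cross 1 s 1 t := by
    rintro s t ⟨h1, h2⟩
    exact h1 ⟨rfl, hf.injective_circle (congrArg Prod.fst h2) (congrArg Prod.snd h2)⟩
  have c01 : ∀ s t, L.proj 0 s = L.proj 1 t → L.Cross 0 s 1 t := fun s t e =>
    ⟨fun h => by simpa using h.1, e⟩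
  -- A self-crossing lying on the circle would be a triple point.
  have mixS : ∀ t, L.proj 1 t ∉ L.signedChanges 0 b σ := by
    rintro t ⟨s, s', h1, h2, h3, e1, e2, _⟩
    exact hf.regular.no_triple _ _ _ _ _ _ (cross_of_lt h1 h2 h3 (e1.trans e2.symm)) (c01 s' t e2)
      (c01 s t e1)
  have hmix' : ∀ s t, L.proj 0 s = L.proj 1 t → (L'.z 1 t < L'.z 0 s ↔ L.z 1 t < L.z 0 s) := by
    intro s t e
    have h1 := (c01 s t e).z_ne
    have h2 : L'.z 0 s ≠ L'.z 1 t :=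
      Cross.z_ne ⟨(c01 s t e).1, by rw [hproj, hproj, e]⟩
    have h3 := hmix s t e
    rw [← not_iff_not, not_lt, not_lt, h1.le_iff_lt, h2.le_iff_lt]
    exact h3
  -- Both passages are translated into the window `[b, b + 1)`, where first and second make sense.
  have rep : ∀ s t, L.Cross 0 s 0 t → ∃ s₀ t₀, b ≤ s₀ ∧ s₀ < b + 1 ∧ b ≤ t₀ ∧ t₀ < b + 1 ∧
      s₀ ≠ t₀ ∧ L.proj 0 s = L.proj 0 s₀ ∧ L.proj 0 s₀ = L.proj 0 t₀ ∧
      L.z 0 s = L.z 0 s₀ ∧ L.z 0 t = L.z 0 t₀ ∧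
      L'.z 0 s = L'.z 0 s₀ ∧ L'.z 0 t = L'.z 0 t₀ := by
    intro s t hc
    obtain ⟨n, s, hs, rfl⟩ := exists_int_add_mem_Ico b s
    obtain ⟨m, t, ht, rfl⟩ := exists_int_add_mem_Ico b t
    have pp : ∀ u (k : ℤ), L.proj 0 (u + k) = L.proj 0 u := fun u k => by
      simp only [proj, periodic_add_int (L.periodic_x 0), periodic_add_int (L.periodic_y 0)]
    refine ⟨s, t, hs.1, hs.2, ht.1, ht.2, ?_, pp _ _, ?_, periodic_add_int (L.periodic_z 0) _ _,
      periodic_add_int (L.periodic_z 0) _ _, periodic_add_int (L'.periodic_z 0) _ _,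
      periodic_add_int (L'.periodic_z 0) _ _⟩
    · rintro rfl
      exact hc.1 ⟨rfl, m - n, by push_cast; ring⟩
    · have := hc.2
      rwa [pp, pp] at this
  refine ⟨hproj, ?_, ?_⟩
  · intro i s j t hc hP
    fin_cases i <;> fin_cases j
    · obtain ⟨s₀, t₀, hs, hs', ht, ht', hne, e, e', z1, z2, z3, z4⟩ := rep s t hc
      change L.proj 0 s ∈ _ at hP
      change L'.z 0 s < L'.z 0 t ↔ L.z 0 t < L.z 0 s
      rw [e] at hP
      rw [z1, z2, z3, z4]
      obtain ⟨u, v, h1, h2, h3, e1, e2, hz⟩ := hP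
      rcases lt_or_gt_of_ne hne with hl | hl
      · obtain ⟨rfl, rfl⟩ := hf.regular.passages_unique h1 h2 h3 hs hl ht' (e1.trans e2.symm) e' e1
        have hm := hmono _ _ hs hl ht' e'
        rcases hσ with rfl | rfl <;> constructor <;> intro _ <;> linarith
      · obtain ⟨rfl, rfl⟩ := hf.regular.passages_unique h1 h2 h3 ht hl hs' (e1.trans e2.symm)
          e'.symm (e1.trans e')
        have hm := hmono _ _ ht hl hs' e'.symm
        rcases hσ with rfl | rfl <;> constructor <;> intro _ <;> linarith
    · have e : L.proj 0 s = L.proj 1 t := hc.2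
      exact absurd (e ▸ hP : L.proj 1 t ∈ _) (mixS t)
    · exact absurd hP (mixS s)
    · exact absurd hc (c11 s t)
  · intro i s j t hc hP
    fin_cases i <;> fin_cases j
    · obtain ⟨s₀, t₀, hs, hs', ht, ht', hne, e, e', z1, z2, z3, z4⟩ := rep s t hc
      change L.proj 0 s ∉ _ at hP
      change L'.z 0 s < L'.z 0 t ↔ L.z 0 s < L.z 0 t
      have hzne : L.z 0 s₀ ≠ L.z 0 t₀ := by
        rw [← z1, ← z2]
        exact hc.z_ne
      rw [e] at hP
      rw [z1, z2, z3, z4]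
      rcases lt_or_gt_of_ne hne with hl | hl
      · have hm := hmono _ _ hs hl ht' e'
        have hn : ¬ σ * L.z 0 s₀ < σ * L.z 0 t₀ := fun hz =>
          hP ⟨s₀, t₀, hs, hl, ht', rfl, e'.symm, hz⟩
        rcases hσ with rfl | rfl <;> rcases lt_or_gt_of_ne hzne with hh | hh <;> constructor <;>
          intro _ <;> linarith
      · have hm := hmono _ _ ht hl hs' e'.symm
        have hn : ¬ σ * L.z 0 t₀ < σ * L.z 0 s₀ := fun hz =>
          hP ⟨t₀, s₀, ht, hl, hs', e'.symm, rfl, hz⟩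
        rcases hσ with rfl | rfl <;> rcases lt_or_gt_of_ne hzne with hh | hh <;> constructor <;>
          intro _ <;> linarith
    · exact hmix s t hc.2
    · exact hmix' t s hc.2.symm
    · exact absurd hc (c11 s t)

/-! ### The base point and the monotone models -/

/-- The leftmost point of the circle and the half-line on the right have a positive distance from
the first component. -/
theorem IsParallelStrandsDiskForm.exists_gap (hf : L.IsParallelStrandsDiskForm p q h r) :
    ∃ δ > 0, ∀ t X, (X = p - r ∨ p + r ≤ X) → δ ^ 2 < (L.x 0 t - X) ^ 2 + (L.y 0 t - q) ^ 2 := by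
  let T : Set (ℝ × ℝ) := {P | P.2 = q ∧ (P.1 = p - r ∨ p + r ≤ P.1)}
  have hT : IsClosed T := by
    refine (isClosed_eq continuous_snd continuous_const).inter ?_
    exact (isClosed_eq continuous_fst continuous_const).union
      (isClosed_le continuous_const continuous_fst)
  have hne : T.Nonempty := ⟨(p - r, q), rfl, Or.inl rfl⟩
  have hc : Continuous (L.proj 0) :=
    (L.contDiff_x 0).continuous.prodMk (L.contDiff_y 0).continuous
  have hpos : ∀ t, 0 < Metric.infDist (L.proj 0 t) T := by
    intro t
    refine (hT.notMem_iff_infDist_pos hne).1 ?_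
    rintro ⟨h1, h2⟩
    have := hf.avoids h1
    rcases h2 with h2 | h2
    · exact this.1 h2
    · exact absurd this.2 (not_lt.2 h2)
  obtain ⟨m, hm, hle⟩ := isCompact_Icc (a := (0 : ℝ)) (b := 1) |>.exists_forall_le' (a := 0)
    (f := fun t => Metric.infDist (L.proj 0 t) T)
    ((Metric.continuous_infDist_pt T).comp hc).continuousOn (fun t _ => hpos t)
  -- `m` bounds the sup distance from below, hence the Euclidean one too; halving makes the
  -- inequality strict.
  refine ⟨m / 2, by positivity, fun t X hX => ?_⟩
  have h1 : m ≤ Metric.infDist (L.proj 0 t) T := by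
    obtain ⟨n, s, hs, rfl⟩ := exists_int_add_mem_Ico 0 t
    rw [show L.proj 0 (s + n) = L.proj 0 s by
      simp only [proj, periodic_add_int (L.periodic_x 0), periodic_add_int (L.periodic_y 0)]]
    exact hle s ⟨hs.1, by linarith [hs.2]⟩
  have h2 : m ≤ dist (L.proj 0 t) (X, q) :=
    h1.trans (Metric.infDist_le_dist_of_mem ⟨rfl, hX⟩)
  rw [Prod.dist_eq, Real.dist_eq, Real.dist_eq, le_max_iff] at h2
  simp only [proj] at h2
  rw [← sq_abs (L.x 0 t - X), ← sq_abs (L.y 0 t - q)]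
  rcases h2 with h2 | h2
  · nlinarith [sq_nonneg |L.y 0 t - q|]
  · nlinarith [sq_nonneg |L.x 0 t - X|]

/-- Seen from a suitable base point, each of the two monotone resolutions of the first component
is realized by an unlink. -/
theorem IsParallelStrandsDiskForm.exists_base_point (hf : L.IsParallelStrandsDiskForm p q h r)
    (hlk : L.linkingNumber = 0) :
    ∃ b, L.proj 0 b ∉ L.selfCrossings 0 ∧ ∀ σ : ℝ, σ = 1 ∨ σ = -1 → ∃ L' : Link (Fin 2),
      L'.IsUnlink ∧ (∀ i t, L'.proj i t = L.proj i t) ∧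
      (∀ s t, b ≤ s → s < t → t < b + 1 → L.proj 0 s = L.proj 0 t →
        σ * L'.z 0 t < σ * L'.z 0 s) ∧
      ∀ s t, L.proj 0 s = L.proj 1 t → (L'.z 0 s < L'.z 1 t ↔ L.z 0 s < L.z 1 t) := by
  have hr := hf.radius_pos
  obtain ⟨ε, hε, hthr⟩ := hf.exists_sign
  have sx := L.contDiff_x 0
  have sy := L.contDiff_y 0
  have px := L.periodic_x 0
  have py := L.periodic_y 0
  have proj_eq_iff : ∀ {s t}, L.proj 0 s = L.proj 0 t ↔ L.x 0 s = L.x 0 t ∧ L.y 0 s = L.y 0 t :=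
    Prod.mk_inj
  obtain ⟨w, sw, pw, hw⟩ := hf.exists_periodic_log hlk
  obtain ⟨δ, hδ, gap⟩ := hf.exists_gap
  obtain ⟨b, hb⟩ := exists_farthest sx sy px py (p - r) q
  have b0 : 0 < sqDist (L.x 0) (L.y 0) (p - r) q b :=
    (pow_pos hδ 2).trans (gap b (p - r) (Or.inl rfl))
  have bcross : L.proj 0 b ∉ L.selfCrossings 0 := by
    rintro ⟨s, t, hc, e⟩
    have e1 := proj_eq_iff.1 e
    have e2 := proj_eq_iff.1 (hc.2.symm.trans e)
    exact hf.regular.transverse 0 s 0 t hc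
      (planarDet_eq_zero_of_farthest sx sy hb b0 e1.1 e1.2 e2.1 e2.2)
  refine ⟨b, bcross, ?_⟩
  have buniq : ∀ t, L.x 0 t = L.x 0 b → L.y 0 t = L.y 0 b → ∃ n : ℤ, t = b + n := by
    intro t h1 h2
    by_contra hne
    exact bcross ⟨b, t, ⟨fun h => hne h.2, proj_eq_iff.2 ⟨h1.symm, h2.symm⟩⟩, rfl⟩
  -- Move the centre `(p - r, q)` slightly away from the farthest point.
  let vx := L.x 0 b - (p - r)
  let vy := L.y 0 b - q
  obtain ⟨l, hl, hlδ⟩ : ∃ l > 0, l ^ 2 * (vx ^ 2 + vy ^ 2) < δ ^ 2 := by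
    have b1 : 0 < vx ^ 2 + vy ^ 2 := b0
    have hv : 0 < Real.sqrt (vx ^ 2 + vy ^ 2) := Real.sqrt_pos.2 b1
    -- The centre moves by exactly `δ / 2`.
    refine ⟨δ / 2 / Real.sqrt (vx ^ 2 + vy ^ 2), by positivity, ?_⟩
    rw [div_pow, Real.sq_sqrt b1.le, div_mul_cancel₀ _ b1.ne']
    nlinarith
  obtain ⟨η, hη, hinj⟩ := exists_injOn_near sx sy (hf.regular.immersed 0 b)
  obtain ⟨t₀, t₁, m, ht₀, ht₀b, hbt₁, ht₁, ht₁₀, hin, hout, d₀, d₁⟩ :=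
    exists_arc_near_farthest sx sy px py hb (hf.regular.immersed 0 b) buniq hl hη
  let D : ℝ → ℝ := sqDist (L.x 0) (L.y 0) (p - r - l * vx) (q - l * vy)
  have hab : t₀ < t₁ := ht₀b.trans hbt₁
  have hin : ∀ t ∈ Set.Icc t₀ t₁, m ≤ D t := hin
  have hout : ∀ t ∈ Set.Ioo t₁ (t₀ + 1), D t < m := hout
  -- The first component descends from `b` on.
  have hdesc : ∀ s t, b ≤ s → s < t → t < b + 1 → L.proj 0 s = L.proj 0 t →
      bumpSin t₀ t₁ t < bumpSin t₀ t₁ s := by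
    intro s t h1 h2 h3 e
    obtain ⟨ex, ey⟩ := proj_eq_iff.1 e
    have eD : D s = D t := by simp only [D, sqDist, ex, ey]
    have pD : ∀ t, D (t + 1) = D t := periodic_sqDist px py _ _
    have hin' : ∀ t ∈ Set.Icc (t₀ + 1) (b + 1), m ≤ D t := fun t ht => by
      have := pD (t - 1)
      rw [sub_add_cancel] at this
      rw [this]
      exact hin _ ⟨by linarith [ht.1], by linarith [ht.2]⟩
    have xs : ∀ t, L.x 0 (t - 1) = L.x 0 t := px.sub_eq
    have ys : ∀ t, L.y 0 (t - 1) = L.y 0 t := py.sub_eq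
    have hshift : ∀ s ∈ Set.Icc (b - η) (b + η), ∀ t ∈ Set.Icc (b - η + 1) (b + η + 1),
        L.x 0 s = L.x 0 t → L.y 0 s = L.y 0 t → s = t - 1 := fun s hs t ht ex ey =>
      hinj s hs (t - 1) ⟨by linarith [ht.1], by linarith [ht.2]⟩ (ex.trans (xs t).symm)
        (ey.trans (ys t).symm)
    -- It suffices that both passages lie in the falling interval `[t₁, t₀ + 1]`. A passage on the
    -- arc around `b` cannot meet one outside, where `D` is smaller, nor another on the arc, where
    -- the projection is injective; shifts by one period treat the end near `b + 1`.
    refine strictAntiOn_bumpSin hab ht₁₀ (?_ : s ∈ _) (?_ : t ∈ _) h2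
    · refine ⟨?_, ?_⟩
      · by_contra! hs
        rcases le_or_gt t t₁ with h4 | h4
        · exact h2.ne (hinj s ⟨by linarith, by linarith⟩ t ⟨by linarith, by linarith⟩ ex ey)
        rcases lt_or_ge t (t₀ + 1) with h5 | h5
        · linarith [hout t ⟨h4, h5⟩, hin s ⟨by linarith, hs.le⟩]
        · have := hshift s ⟨by linarith, by linarith⟩ t ⟨by linarith, by linarith⟩ ex ey
          linarith
      · by_contra! hs
        have := hshift (s - 1) ⟨by linarith, by linarith⟩ t ⟨by linarith, by linarith⟩
          ((xs s).trans ex) ((ys s).trans ey)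
        linarith
    · refine ⟨?_, ?_⟩
      · by_contra! h4
        exact h2.ne (hinj s ⟨by linarith, by linarith⟩ t ⟨by linarith, by linarith⟩ ex ey)
      · by_contra! h4
        rcases le_or_gt s t₁ with h5 | h5
        · have := hshift s ⟨by linarith, by linarith⟩ t ⟨by linarith, by linarith⟩ ex ey
          linarith
        rcases lt_or_ge s (t₀ + 1) with h6 | h6
        · linarith [hout s ⟨h5, h6⟩, hin' t ⟨h4.le, h3.le⟩]
        · have := hshift (s - 1) ⟨by linarith, by linarith⟩ t ⟨by linarith, by linarith⟩
            ((xs s).trans ex) ((ys s).trans ey)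
          linarith
  have hself : ∀ s t, L.x 0 s = L.x 0 t → L.y 0 s = L.y 0 t →
      bumpSin t₀ t₁ s = bumpSin t₀ t₁ t → ∃ n : ℤ, t = s + n := by
    intro s t h1 h2 h3
    obtain ⟨k, s, hs, rfl⟩ := exists_int_add_mem_Ico b s
    obtain ⟨j, t, ht, rfl⟩ := exists_int_add_mem_Ico b t
    simp only [periodic_add_int px, periodic_add_int py, periodic_add_int periodic_bumpSin]
      at h1 h2 h3
    rcases lt_trichotomy s t with h | h | h
    · exact absurd h3 (hdesc s t hs.1 h ht.2 (proj_eq_iff.2 ⟨h1, h2⟩)).ne'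
    · exact ⟨j - k, by rw [h]; push_cast; ring⟩
    · exact absurd h3 (hdesc t s ht.1 h hs.2 (proj_eq_iff.2 ⟨h1.symm, h2.symm⟩)).ne
  -- Polar coordinates around the new centre.
  let α : ℝ → ℂ := fun t => ⟨L.x 0 t - (p - r), L.y 0 t - q⟩
  let u : ℂ := ⟨l * vx, l * vy⟩
  have nα : ∀ t, ‖u‖ < ‖α t‖ := by
    intro t
    have h1 := gap t (p - r) (Or.inl rfl)
    refine lt_of_pow_lt_pow_left₀ 2 (norm_nonneg _) ?_
    rw [Complex.sq_norm, Complex.sq_norm, Complex.normSq_apply, Complex.normSq_apply]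
    simp only [u, α]
    nlinarith
  have hslit : ∀ t, 1 + u / Complex.exp (w t) ∈ Complex.slitPlane := by
    intro t
    rw [hw]
    apply Complex.mem_slitPlane_of_norm_lt_one
    rw [norm_div, div_lt_one ((norm_nonneg _).trans_lt (nα t))]
    exact nα t
  -- Since `‖u‖ < ‖α t‖`, the principal logarithm of `1 + u / α` corrects the old logarithm to the
  -- new centre and preserves its periodicity.
  let W : ℝ → ℂ := fun t => w t + Complex.log (1 + u / Complex.exp (w t))
  have sW : ContDiff ℝ ∞ W := by
    have h1 : ContDiff ℝ ∞ (fun t => 1 + u / Complex.exp (w t)) := by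
      have : ContDiff ℝ ∞ (fun t => Complex.exp (w t)) := sw.cexp
      simp only [div_eq_mul_inv]
      exact contDiff_const.add (contDiff_const.mul (this.inv fun t => Complex.exp_ne_zero _))
    refine sw.add ?_
    rw [contDiff_iff_contDiffAt]
    intro t
    exact ((Complex.contDiffAt_log (hslit t)).restrict_scalars ℝ).comp t h1.contDiffAt
  have pW : Function.Periodic W 1 := fun t => by simp only [W, pw t]
  have eW : ∀ t, Complex.exp (W t) =
      ⟨L.x 0 t - (p - r - l * vx), L.y 0 t - (q - l * vy)⟩ := by
    intro t
    simp only [W]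
    rw [Complex.exp_add, Complex.exp_log (Complex.slitPlane_ne_zero (hslit t)), mul_add, mul_one,
      mul_div_cancel₀ _ (Complex.exp_ne_zero _), hw]
    apply Complex.ext <;> simp [u] <;> ring
  let ρ : ℝ → ℝ := fun t => Real.exp (W t).re
  let φ : ℝ → ℝ := fun t => (W t).im
  have sρ : ContDiff ℝ ∞ ρ := Real.contDiff_exp.comp (Complex.reCLM.contDiff.comp sW)
  have sφ : ContDiff ℝ ∞ φ := Complex.imCLM.contDiff.comp sW
  have pρ : Function.Periodic ρ 1 := fun t => by simp only [ρ, pW t]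
  have pφ : Function.Periodic φ 1 := fun t => by simp only [φ, pW t]
  have ρpos : ∀ t, 0 < ρ t := fun t => Real.exp_pos _
  have exρ : ∀ t, ρ t * Real.cos (φ t) = L.x 0 t - (p - r - l * vx) := fun t => by
    rw [← Complex.exp_re, eW]
  have eyρ : ∀ t, ρ t * Real.sin (φ t) = L.y 0 t - (q - l * vy) := fun t => by
    rw [← Complex.exp_im, eW]
  have hD : ∀ t, D t = ρ t ^ 2 := by
    intro t
    simp only [D, sqDist]
    rw [← exρ, ← eyρ]
    linear_combination ρ t ^ 2 * Real.cos_sq_add_sin_sq (φ t)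
  have dD : ∀ t, deriv D t = 2 * ρ t * deriv ρ t := by
    intro t
    rw [show D = fun t => ρ t ^ 2 from funext hD]
    exact (((sρ.differentiable (by simp) t).hasDerivAt.pow 2).congr_deriv (by simp)).deriv
  have da : 0 < deriv ρ t₀ := by
    have : 0 < deriv D t₀ := d₀
    rw [dD] at this
    exact (mul_pos_iff_of_pos_left (by linarith [ρpos t₀])).1 this
  have db : deriv ρ t₁ < 0 := by
    have : deriv D t₁ < 0 := d₁
    rw [dD] at this
    by_contra! hn
    exact absurd this (not_lt.2 (mul_nonneg (by linarith [ρpos t₁]) hn))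
  obtain ⟨B, hB⟩ : ∃ B, ∀ t, ρ t ≤ B := by
    obtain ⟨c, _, hc⟩ := isCompact_Icc.exists_isMaxOn (Set.nonempty_Icc.2 (zero_le_one' ℝ))
      sρ.continuous.continuousOn
    refine ⟨ρ c, fun t => ?_⟩
    obtain ⟨n, s, hs, rfl⟩ := exists_int_add_mem_Ico 0 t
    rw [periodic_add_int pρ]
    exact hc ⟨hs.1, by linarith [hs.2]⟩
  have hB0 : 0 < B := (ρpos 0).trans_le (hB 0)
  have habs : ∀ σ : ℝ, σ = 1 ∨ σ = -1 → |σ| = 1 := by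
    rintro σ (rfl | rfl) <;> simp
  intro σ hσ
  -- `E` is so large that the diameter of the enlarged circle exceeds `3/2` and all radii `ρ ≤ B`,
  -- and that its rightmost point never moves left. The arcs are separated by the radius `√m`, as `D
  -- = ρ²`.
  obtain ⟨M, hM, hlink, hunlink⟩ := isUnlink_of_descending (p := p) (q := q) (r := r)
    (dx := -(l * vx)) (dy := -(l * vy)) (E := 1 + |l * vx| + B) (m := Real.sqrt m)
    sx sy px py (hf.regular.immersed 0) hf.isCircleParam hab ht₁₀ (habs σ hσ) (habs ε hε) hr
    (by positivity) (by linarith [abs_nonneg (l * vx)]) hself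
    (by
      rintro τ ⟨h0, h1⟩ t e1 e2
      have := gap t (p - r) (Or.inl rfl)
      rw [e1, e2] at this
      have h2 : τ ^ 2 ≤ 1 := pow_le_one₀ h0 h1
      have h3 : 0 ≤ l ^ 2 * (vx ^ 2 + vy ^ 2) := by positivity
      nlinarith)
    (by
      rintro τ ⟨h0, h1⟩ t e1 e2
      have h4 : l * vx ≤ |l * vx| := le_abs_self _
      have h5 : 0 ≤ τ * (2 * |l * vx| - l * vx + 2 + 2 * B) :=
        mul_nonneg h0 (by linarith [abs_nonneg (l * vx)])
      -- The rightmost point strays from the half-line only by `τ * l * vy` in the `y`-direction,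
      -- which is less than the gap.
      have := gap t (L.x 0 t) (Or.inr (by rw [e1]; linarith))
      rw [e2] at this
      have h2 : τ ^ 2 ≤ 1 := pow_le_one₀ h0 h1
      have h3 : 0 ≤ l ^ 2 * vy ^ 2 := by positivity
      have h6 : 0 ≤ l ^ 2 * vx ^ 2 := by positivity
      nlinarith)
    sρ sφ pρ pφ ρpos
    (fun t => by linarith [hB t, abs_nonneg (l * vx)])
    (fun t => by rw [exρ]; ring) (fun t => by rw [eyρ]; ring)
    (fun t ht => Real.sqrt_le_iff.2 ⟨(ρpos t).le, by rw [← hD]; exact hin t ht⟩)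
    (fun t ht => Real.lt_sqrt_of_sq_lt (by rw [← hD]; exact hout t ht)) da db
  refine ⟨⟨_, hlink⟩, hunlink _ rfl, ?_, ?_, ?_⟩
  · intro i t
    fin_cases i
    · rfl
    · have : ∀ a c : ℝ, a + r * ((c - a) / r) = c := fun a c => by
        field_simp
        ring
      exact Prod.ext (this p (L.x 1 t)) (this q (L.y 1 t))
  · intro s t h1 h2 h3 e
    change σ * (σ * bumpSin t₀ t₁ t) < σ * (σ * bumpSin t₀ t₁ s)
    have σ2 : σ * σ = 1 := by rcases hσ with rfl | rfl <;> norm_num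
    rw [← mul_assoc, ← mul_assoc, σ2, one_mul, one_mul]
    exact hdesc s t h1 h2 h3 e
  · intro s t e
    have ex : L.x 0 s = L.x 1 t := congrArg Prod.fst e
    have ey : L.y 0 s = L.y 1 t := congrArg Prod.snd e
    change σ * bumpSin t₀ t₁ s < 0 + -(ε * M * r) * ((L.y 1 t - q) / r) ↔ _
    have e1 : 0 + -(ε * M * r) * ((L.y 1 t - q) / r) = -(ε * (M * (L.y 0 s - q))) := by
      rw [ey]
      field_simp
      ring
    have hc : (L.x 0 s - p) ^ 2 + (L.y 0 s - q) ^ 2 = r ^ 2 := by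
      rw [ex, ey]
      exact (hf.on_circle t).1
    have h1 := hM s hc
    have h2 := hthr s hc
    have h3 : |σ * bumpSin t₀ t₁ s| ≤ 1 := by
      rw [abs_mul, habs σ hσ, one_mul]
      exact abs_bumpSin_le hab ht₁₀ s
    obtain ⟨h4, h5⟩ := abs_le.1 h3
    rw [e1, (hf.on_circle t).2]
    rw [← mul_assoc] at h2
    -- The side of the diameter on which the crossing lies decides, in the original and in the
    -- tilted model alike, which component is over.
    have h6 : ε * (L.y 0 s - q) = |L.y 0 s - q| ∨ ε * (L.y 0 s - q) = -|L.y 0 s - q| := by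
      rcases hε with rfl | rfl <;> rcases abs_choice (L.y 0 s - q) with h | h <;> rw [h] <;> simp
    have hM' : ε * (M * (L.y 0 s - q)) = M * (ε * (L.y 0 s - q)) := by ring
    rw [hM']
    have hn := abs_nonneg (L.y 0 s - q)
    rcases h6 with h9 | h9 <;> rw [h9] at h2 ⊢
    · have h7 : h < L.z 0 s := by
        by_contra! h8
        exact absurd h2 (not_lt.2 (mul_nonpos_of_nonneg_of_nonpos hn (sub_nonpos.2 h8)))
      constructor <;> intro _ <;> linarith
    · have h7 : L.z 0 s < h := by
        by_contra! h8
        have := mul_nonneg hn (sub_nonneg.2 h8)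
        linarith
      constructor <;> intro _ <;> linarith

end Link

end ColoredUnlinking

theorem proposition3p2 (L : ColoredUnlinking.Link (Fin 2)) (p q h r : ℝ)
    (hform : L.IsParallelStrandsDiskForm p q h r)
    (hknots : ∀ i, (L.component i).IsUnlink)
    (hlk : L.linkingNumber = 0) :
    (∃ b : ℝ, L.proj 0 b ∉ L.selfCrossings 0 ∧
      L.ChangeYieldsUnlink (L.descendingChanges 0 b) ∧
      L.ChangeYieldsUnlink (L.ascendingChanges 0 b) ∧
      min (L.descendingChanges 0 b).ncard (L.ascendingChanges 0 b).ncard ≤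
        (L.selfCrossings 0).ncard / 2) ∧
    L.Unlinkable ((L.selfCrossings 0).ncard / 2) 0 := by
  obtain ⟨b, hb, hchange⟩ := hform.exists_base_point hlk
  have yields : ∀ σ : ℝ, σ = 1 ∨ σ = -1 → L.ChangeYieldsUnlink (L.signedChanges 0 b σ) := by
    intro σ hσ
    obtain ⟨L', hu, hproj, hmono, hmix⟩ := hchange σ hσ
    have hc := hform.isCrossingChange hσ hproj hmono hmix
    -- One model suffices, as links with the same changed diagram are isotopic.
    exact ⟨⟨L', hc⟩, fun L'' h'' => (h''.isotopic hform.regular hc).trans hu⟩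
  have hdown := yields 1 (Or.inl rfl)
  have hup := yields (-1) (Or.inr rfl)
  have sdown := L.signedChanges_subset 0 b 1
  have sup := L.signedChanges_subset 0 b (-1)
  rw [ColoredUnlinking.Link.signedChanges_one] at hdown sdown
  rw [ColoredUnlinking.Link.signedChanges_neg_one] at hup sup
  have hmin := ColoredUnlinking.Link.min_ncard_changes_le hform.regular 0 b
  refine ⟨⟨b, hb, hdown, hup, hmin⟩, L, ColoredUnlinking.Isotopic.refl L, hform.regular, ?_⟩
  rcases min_le_iff.1 hmin with hle | hle
  · exact ⟨_, ∅, sdown, Set.empty_subset _, hle, by simp, by rwa [Set.union_empty]⟩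
  · exact ⟨_, ∅, sup, Set.empty_subset _, hle, by simp, by rwa [Set.union_empty]⟩
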